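/- Let $A$ be a finite alphabet. A picture over $A$ of shape $(m,n)$, $m,n\ge 1$, is a function $p:\{0,\dots,m-1\}\times\{0,\dots,n-1\}\to A$ (first coordinate horizontal, second vertical). A domino language over a finite alphabet $G$ is the set of all pictures over $G$ that, after being surrounded by one layer of a new symbol $\#$, contain none of a given set of forbidden horizontal and vertical dominoes over $G\cup\{\#\}$; a picture language is recognizable if it is the image of a domino language over some finite alphabet under a symbol-to-symbol map. For a picture language $L$ and $n\in\mathbb N$ put $$S_H(n)=\inf\{m : L \text{ contains a picture of shape } (m,n)\},\qquad S_V(n)=\inf\{m : L \text{ contains a picture of shape } (n,m)\}$$ in $\mathbb N\cup\{\infty\}$, and define the relaxed size functions $$S'_H(n)=\sup\{S_H(n') : n'\le n,\ S_H(n')<\infty\},\quad S'_V(n)=\sup\{S_V(n') : n'\le n,\ S_V(n')<\infty\},\quad S'(n)=\max(S'_H(n),S'_V(n)),$$ where $\sup\emptyset=0$. A $\mathbb Z^2$-shift of finite type (SFT) over a finite alphabet $C$ is a set $X\subseteq C^{\mathbb Z^2}$ consisting of all configurations in which no translate of any of finitely many forbidden finite patterns occurs; a pattern is globally valid in $X$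 if it occurs in some element of $X$. Let $B_H(n)$ (respectively $B_V(n)$) be the smallest $k\in\mathbb N$ such that for any two globally valid $n\times n$ patterns $p,q$ there is a configuration in $X$ in which $q$ occurs directly to the right of $p$ (respectively directly above $p$) with exactly $k$ columns (respectively rows) between them, and $\infty$ if there is no such $k$. Let $B(n)=\max(B_H(n),B_V(n))$. **Theorem.** Let $L$ be a recognizable picture language over a finite alphabet. Then there exists a $\mathbb Z^2$-SFT such that $$B_H(n)\ge 2S'_H(n)+1 \quad\text{and}\quad B_V(n)\ge 2S'_V(n)+1 \qquad\text{for all } n\ge 1,$$ and $$B(n)=\max(3,\,2S'(n)+1)\qquad\text{for all sufficiently large } n.$$ -/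

import Mathlib

namespace BlockGluing

/-! ### Pictures and recognizable picture languages -/

/-- A (nonempty) picture over `A`: a function on `{0,…,width-1} × {0,…,height-1}`. The first
coordinate is horizontal, the second one vertical (increasing upward). -/
structure Picture (A : Type*) where
  width : ℕ
  height : ℕ
  width_pos : 0 < width
  height_pos : 0 < height
  cell : Fin width → Fin height → A

/-- The shape `(width, height)` of a picture. -/
def Picture.shape {A : Type*} (p : Picture A) : ℕ × ℕ := (p.width, p.height)

/-- Symbolwise projection of a picture. -/
def Picture.map {A C : Type*} (π : A → C) (p : Picture A) : Picture C where
  width := p.width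
  height := p.height
  width_pos := p.width_pos
  height_pos := p.height_pos
  cell := fun i j => π (p.cell i j)

/-- The padded picture, with domain `{0,…,width+1} × {0,…,height+1}`: the picture `p` shifted by
`(1,1)` and surrounded by one layer of the special symbol, which is `none` here. (Values outside
this domain are never used.) -/
def Picture.padded {A : Type*} (p : Picture A) (i j : ℕ) : Option A :=
  if h : (1 ≤ i ∧ i - 1 < p.width) ∧ (1 ≤ j ∧ j - 1 < p.height) then
    some (p.cell ⟨i - 1, h.1.2⟩ ⟨j - 1, h.2.2⟩)
  else none

/-- The domino language given by a set `H` of forbidden horizontal dominoes (left, right) and a set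
`V` of forbidden vertical dominoes (lower, upper), over the alphabet with the padding symbol. -/
def dominoLanguage {A : Type*} (H V : Set (Option A × Option A)) : Set (Picture A) :=
  {p | (∀ i j : ℕ, i + 1 < p.width + 2 → j < p.height + 2 →
          (p.padded i j, p.padded (i + 1) j) ∉ H) ∧
       (∀ i j : ℕ, i < p.width + 2 → j + 1 < p.height + 2 →
          (p.padded i j, p.padded i (j + 1)) ∉ V)}

/-- A picture language is recognizable if it is a symbolwise projection of a domino language over
some finite alphabet. -/
def IsRecognizable {A : Type*} (L : Set (Picture A)) : Prop :=
  ∃ (G : Type) (_ : Finite G) (H V : Set (Option G × Option G)) (π : G → A),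
    L = Picture.map π '' dominoLanguage H V

/-- The set of shapes of the pictures in `L`. -/
def shapes {A : Type*} (L : Set (Picture A)) : Set (ℕ × ℕ) := Picture.shape '' L

/-! ### Size functions -/

/-- `S_H(n)`: the least width of a picture of height `n` in `L` (`⊤` if there is none). -/
noncomputable def sizeH {A : Type*} (L : Set (Picture A)) (n : ℕ) : ℕ∞ :=
  sInf {s : ℕ∞ | ∃ m : ℕ, (m, n) ∈ shapes L ∧ s = (m : ℕ∞)}

/-- `S_V(n)`: the least height of a picture of width `n` in `L` (`⊤` if there is none). -/
noncomputable def sizeV {A : Type*} (L : Set (Picture A)) (n : ℕ) : ℕ∞ :=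
  sInf {s : ℕ∞ | ∃ m : ℕ, (n, m) ∈ shapes L ∧ s = (m : ℕ∞)}

/-- `S'_H(n)`: the supremum of the finite values of `S_H` on `{0,…,n}`. -/
noncomputable def relaxedSizeH {A : Type*} (L : Set (Picture A)) (n : ℕ) : ℕ∞ :=
  sSup {s : ℕ∞ | ∃ n' : ℕ, n' ≤ n ∧ sizeH L n' < ⊤ ∧ s = sizeH L n'}

/-- `S'_V(n)`: the supremum of the finite values of `S_V` on `{0,…,n}`. -/
noncomputable def relaxedSizeV {A : Type*} (L : Set (Picture A)) (n : ℕ) : ℕ∞ :=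
  sSup {s : ℕ∞ | ∃ n' : ℕ, n' ≤ n ∧ sizeV L n' < ⊤ ∧ s = sizeV L n'}

/-- `S'(n) = max (S'_H(n)) (S'_V(n))`. -/
noncomputable def relaxedSize {A : Type*} (L : Set (Picture A)) (n : ℕ) : ℕ∞ :=
  max (relaxedSizeH L n) (relaxedSizeV L n)

/-! ### Shifts of finite type -/

/-- The shift action: `(σ^v x)_u = x_(u+v)`. -/
def shift {C : Type*} (v : ℤ × ℤ) (x : ℤ × ℤ → C) : ℤ × ℤ → C := fun u => x (u + v)

/-- The cylinder set `[p]` of a pattern `p` with finite domain `D`. -/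
def cylinder {C : Type*} {D : Finset (ℤ × ℤ)} (p : D → C) : Set (ℤ × ℤ → C) :=
  {x | ∀ u : D, x u = p u}

/-- `X` is a shift of finite type: it is defined by a finite set `F` of forbidden finite
patterns (each one given together with its domain). -/
def IsSFT {C : Type*} (X : Set (ℤ × ℤ → C)) : Prop :=
  ∃ F : Set (Σ D : Finset (ℤ × ℤ), (D → C)), F.Finite ∧
    X = {x | ∀ v : ℤ × ℤ, ∀ p ∈ F, shift v x ∉ cylinder p.2}

/-! ### Block gluing functions -/

/-- The square `{0,…,n-1} × {0,…,n-1}`. -/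
noncomputable def square (n : ℕ) : Finset (ℤ × ℤ) := Finset.Ico (0 : ℤ) n ×ˢ Finset.Ico (0 : ℤ) n

/-- The globally valid `n × n` patterns of `X`. -/
def language {C : Type*} (X : Set (ℤ × ℤ → C)) (n : ℕ) : Set (square n → C) :=
  {p | (X ∩ cylinder p).Nonempty}

/-- Any two globally valid `n × n` patterns can be glued in `X`, the second one to the right of the
first one, with exactly `k` columns between them. -/
def GluesH {C : Type*} (X : Set (ℤ × ℤ → C)) (n k : ℕ) : Prop :=
  ∀ p ∈ language X n, ∀ q ∈ language X n,
    (X ∩ cylinder p ∩ shift (-((n : ℤ) + k), 0) '' cylinder q).Nonempty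

/-- Any two globally valid `n × n` patterns can be glued in `X`, the second one above the first
one, with exactly `k` rows between them. -/
def GluesV {C : Type*} (X : Set (ℤ × ℤ → C)) (n k : ℕ) : Prop :=
  ∀ p ∈ language X n, ∀ q ∈ language X n,
    (X ∩ cylinder p ∩ shift (0, -((n : ℤ) + k)) '' cylinder q).Nonempty

/-- The horizontal block gluing function: the least gap that works, `⊤` if there is none. -/
noncomputable def blockGluingH {C : Type*} (X : Set (ℤ × ℤ → C)) (n : ℕ) : ℕ∞ :=
  sInf {s : ℕ∞ | ∃ k : ℕ, GluesH X n k ∧ s = (k : ℕ∞)}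

/-- The vertical block gluing function: the least gap that works, `⊤` if there is none. -/
noncomputable def blockGluingV {C : Type*} (X : Set (ℤ × ℤ → C)) (n : ℕ) : ℕ∞ :=
  sInf {s : ℕ∞ | ∃ k : ℕ, GluesV X n k ∧ s = (k : ℕ∞)}

/-- The block gluing function. -/
noncomputable def blockGluing {C : Type*} (X : Set (ℤ × ℤ → C)) (n : ℕ) : ℕ∞ :=
  max (blockGluingH X n) (blockGluingV X n)

end BlockGluing

namespace BlockGluing

/-! ### Domino systems and walks on their columns -/

/-! The shift is a product of two layers. The first shows pictures of a domino system built from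
that of `L`, on a blank background and possibly broken; the second does the same for the transposed
language, with the axes exchanged. The first layer makes horizontal gluing expensive and is cheap
vertically, where one blank row suffices; the second layer is the opposite.

Lower bound. `bordered` adds a separate first and last column which fit horizontally to nothing;
`timed` lets any column be followed by the start of a picture or preceded by the end of one. Let a
pattern end on the right in a first border column of height `h`, and let another begin on the left
with a last border column of the same height. A whole picture of height `h` must follow the former
and precede the latter, so each needs at least `S_H(h)` more columns of tiles. Colours differ
between the two pictures and are constant along rows of tiles, so some further column must separate
them: the gap is at least `2 S_H(h) + 1` (`lt_of_glued`).

Upper bound. A pattern of size `n` has to be closed within `s = S'(n)` columns on each side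
(`exists_confined`). A column that lacks the mark at one end can be ended at once along a crack
(`exists_closed_right`). A column marked at both ends cannot: the local rule continues it until an
edge. The clock strictly increases from column to column, so the edge is reached after finitely many
steps on both sides (`IsRun.exists_ends`). Hence a picture of that height exists, which is why only
the finite values of `S_H` matter, and a restart replaces the continuation by a minimal picture
(`exists_timed_ends_le`). Two patterns closed in this way need only one common blank column between
them: the gap `2s + 1` works.

The clock must not exclude the minimal pictures themselves. Their columns are pairwise distinct
(`exists_injective_walk`), so these columns, sorted, supply enough clock values
(`exists_clock_walk`).

If `L` is nonempty then `S'(n) ≥ 1` eventually, so the constant 3 plays no role; for empty `L` the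
shift of the language of all unary pictures has the value 3. -/

/-- A domino system, given by its allowed dominoes; the dominoes with the padding symbol are
given by the four boundary predicates. -/
structure Dominoes (T : Type) where
  hor : T → T → Prop
  ver : T → T → Prop
  left : T → Prop
  right : T → Prop
  bottom : T → Prop
  top : T → Prop

namespace Dominoes

variable {T : Type}

/-- Reflection at a vertical axis. -/
def mirror (S : Dominoes T) : Dominoes T where
  hor a b := S.hor b a
  ver := S.ver
  left := S.right
  right := S.left
  bottom := S.bottom
  top := S.top

/-- The first `h` entries of `c` form a valid column of height `h`. -/
structure IsCol (S : Dominoes T) (h : ℕ) (c : ℕ → T) : Prop where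
  bottom : S.bottom (c 0)
  top : S.top (c (h - 1))
  ver : ∀ j, j + 1 < h → S.ver (c j) (c (j + 1))

/-- The column `c'` may follow the column `c`. -/
def Step (S : Dominoes T) (h : ℕ) (c c' : ℕ → T) : Prop :=
  S.IsCol h c' ∧ ∀ j < h, S.hor (c j) (c' j)

/-- From the column `c` one can walk to the right edge in `k` steps. -/
def Ends (S : Dominoes T) (h : ℕ) : ℕ → (ℕ → T) → Prop
  | 0, c => ∀ j < h, S.right (c j)
  | k + 1, c => ∃ c', S.Step h c c' ∧ S.Ends h k c'

/-- There is a picture of height `h` and width `m + 1`. -/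
def Has (S : Dominoes T) (h m : ℕ) : Prop :=
  ∃ c, S.IsCol h c ∧ (∀ j < h, S.left (c j)) ∧ S.Ends h m c

theorem IsCol.mirror {S : Dominoes T} {h : ℕ} {c : ℕ → T} (hc : S.IsCol h c) :
    S.mirror.IsCol h c := ⟨hc.1, hc.2, hc.3⟩

theorem ends_congr {S : Dominoes T} {h k : ℕ} {c c' : ℕ → T} (hcc : ∀ j < h, c j = c' j)
    (hc : S.Ends h k c) : S.Ends h k c' := by
  cases k with
  | zero => exact fun j hj => hcc j hj ▸ hc j hj
  | succ k =>
    obtain ⟨d, hd, hk⟩ := hc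
    exact ⟨d, ⟨hd.1, fun j hj => hcc j hj ▸ hd.2 j hj⟩, hk⟩

/-- Columns move one at a time from the left walk to the right one. The common column counts once,
so the width is `l + k + 1`. -/
theorem has_of_ends {S : Dominoes T} {h l k : ℕ} {c : ℕ → T} (hc : S.IsCol h c)
    (hl : S.mirror.Ends h l c) (hk : S.Ends h k c) : S.Has h (l + k) := by
  induction l generalizing k c with
  | zero => exact ⟨c, hc, hl, by simpa using hk⟩
  | succ l ih =>
    obtain ⟨d, hd, hl⟩ := hl
    have := ih (k := k + 1) ⟨hd.1.1, hd.1.2, hd.1.3⟩ hl ⟨c, ⟨hc, fun j hj => hd.2 j hj⟩, hk⟩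
    rwa [show l + 1 + k = l + (k + 1) by omega]

theorem exists_walk {S : Dominoes T} {h k : ℕ} {c : ℕ → T} (hk : S.Ends h k c) :
    ∃ w : ℕ → ℕ → T, w 0 = c ∧ (∀ i < k, S.Step h (w i) (w (i + 1))) ∧
      ∀ j < h, S.right (w k j) := by
  induction k generalizing c with
  | zero => exact ⟨fun _ => c, rfl, by simp, hk⟩
  | succ k ih =>
    obtain ⟨d, hd, hk⟩ := hk
    obtain ⟨w, h0, h1, h2⟩ := ih hk
    refine ⟨fun i => Nat.casesOn i c w, rfl, fun i hi => ?_, h2⟩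
    cases i with
    | zero => simpa [h0] using hd
    | succ i => exact h1 i (by omega)

theorem ends_of_walk {S : Dominoes T} {h k : ℕ} {w : ℕ → ℕ → T}
    (hw : ∀ i < k, S.Step h (w i) (w (i + 1))) (hk : ∀ j < h, S.right (w k j)) :
    ∀ i ≤ k, S.Ends h (k - i) (w i) := by
  intro i hi
  obtain ⟨l, rfl⟩ := Nat.exists_eq_add_of_le hi
  rw [Nat.add_sub_cancel_left]
  clear hi
  induction l generalizing i with
  | zero => exact hk
  | succ l ih =>
    refine ⟨w (i + 1), hw i (by omega), ih (i + 1) (fun a ha => hw a (by omega)) ?_⟩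
    rwa [show i + 1 + l = i + (l + 1) by omega]

theorem mirror_ends_of_walk {S : Dominoes T} {h k : ℕ} {w : ℕ → ℕ → T} (h0 : S.IsCol h (w 0))
    (hl : ∀ j < h, S.left (w 0 j)) (hw : ∀ i < k, S.Step h (w i) (w (i + 1))) :
    ∀ i ≤ k, S.IsCol h (w i) ∧ S.mirror.Ends h i (w i) := by
  intro i hi
  induction i with
  | zero => exact ⟨h0, hl⟩
  | succ i ih =>
    have h1 := ih (by omega)
    have h2 := hw i (by omega)
    exact ⟨h2.1, w i, ⟨h1.1.mirror, h2.2⟩, h1.2⟩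

theorem Has.mirror {S : Dominoes T} {h m : ℕ} (hm : S.Has h m) : S.mirror.Has h m := by
  obtain ⟨c, hc, hl, hk⟩ := hm
  have := has_of_ends (S := S.mirror) (l := m) (k := 0) hc.mirror hk hl
  simpa using this

/-- The columns of a picture of minimal width are distinct. -/
theorem exists_injective_walk {S : Dominoes T} {h m : ℕ} (hm : S.Has h m)
    (hmin : ∀ m', S.Has h m' → m ≤ m') :
    ∃ w : ℕ → ℕ → T, S.IsCol h (w 0) ∧ (∀ j < h, S.left (w 0 j)) ∧
      (∀ i < m, S.Step h (w i) (w (i + 1))) ∧ (∀ j < h, S.right (w m j)) ∧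
      ∀ i i', i < i' → i' ≤ m → ∃ j < h, w i j ≠ w i' j := by
  obtain ⟨c, hc, hl, hk⟩ := hm
  obtain ⟨w, rfl, h1, h2⟩ := exists_walk hk
  refine ⟨w, hc, hl, h1, h2, fun i i' hi hi' => ?_⟩
  -- Cutting out everything between two equal columns would leave a narrower picture.
  by_contra! hcon
  have ha := mirror_ends_of_walk hc hl h1 i (by omega)
  have hb := ends_of_walk h1 h2 i' hi'
  have := hmin _ (has_of_ends ha.1 ha.2 (ends_congr (fun j hj => (hcon j hj).symm) hb))
  omega

/-! ### Adding a separate first and a separate last column -/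

/-- Two new symbols: columns of `inr false` may stand at the left edge, columns of `inr true` at
the right edge, and they fit horizontally to nothing else. -/
def bordered (S : Dominoes T) : Dominoes (T ⊕ Bool) where
  hor
    | .inl a, .inl b => S.hor a b
    | _, _ => False
  ver
    | .inl a, .inl b => S.ver a b
    | .inr a, .inr b => a = b
    | _, _ => False
  left
    | .inl a => S.left a
    | .inr b => b = false
  right
    | .inl a => S.right a
    | .inr b => b = true
  bottom
    | .inl a => S.bottom a
    | .inr _ => True
  top
    | .inl a => S.top a
    | .inr _ => True

theorem isCol_bordered_inl {S : Dominoes T} {h : ℕ} {c : ℕ → T} :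
    S.bordered.IsCol h (fun j => .inl (c j)) ↔ S.IsCol h c :=
  ⟨fun hc => ⟨hc.1, hc.2, hc.3⟩, fun hc => ⟨hc.1, hc.2, hc.3⟩⟩

theorem isCol_bordered_inr (S : Dominoes T) (h : ℕ) (b : Bool) :
    S.bordered.IsCol h (fun _ => .inr b) := ⟨trivial, trivial, fun _ _ => rfl⟩

/-- The vertical rule never mixes old and new symbols, so the lowest symbol decides the kind of the
whole column. -/
theorem exists_inl_of_isCol {S : Dominoes T} {h : ℕ} (hh : 0 < h) {c : ℕ → T ⊕ Bool}
    (hc : S.bordered.IsCol h c) {a : T} (ha : c 0 = .inl a) :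
    ∃ d : ℕ → T, S.IsCol h d ∧ ∀ j < h, c j = .inl (d j) := by
  have key : ∀ j, j < h → ∃ a, c j = .inl a := by
    intro j
    induction j with
    | zero => exact fun _ => ⟨a, ha⟩
    | succ j ih =>
      intro hj
      obtain ⟨b, hb⟩ := ih (by omega)
      have := hc.3 j hj
      rw [hb] at this
      cases hd : c (j + 1) with
      | inl d => exact ⟨d, rfl⟩
      | inr d => rw [hd] at this; exact this.elim
  have : Nonempty T := ⟨a⟩
  choose! d hd using key
  refine ⟨d, ⟨?_, ?_, fun j hj => ?_⟩, hd⟩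
  · have := hc.1; rwa [hd 0 hh] at this
  · have := hc.2; rwa [hd (h - 1) (by omega)] at this
  · have := hc.3 j hj; rwa [hd j (by omega), hd (j + 1) hj] at this

theorem ends_of_bordered {S : Dominoes T} {h k : ℕ} (hh : 0 < h) {c : ℕ → T}
    (hk : S.bordered.Ends h k (fun j => .inl (c j))) : S.Ends h k c := by
  induction k generalizing c with
  | zero => exact hk
  | succ k ih =>
    obtain ⟨d, hd, hk⟩ := hk
    have h0 := hd.2 0 hh
    cases h1 : d 0 with
    | inr b => rw [h1] at h0; exact h0.elim
    | inl a =>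
      obtain ⟨e, he, hde⟩ := exists_inl_of_isCol hh hd.1 h1
      refine ⟨e, ⟨he, fun j hj => ?_⟩, ih (ends_congr hde hk)⟩
      have := hd.2 j hj
      rwa [hde j hj] at this

theorem ends_bordered {S : Dominoes T} {h k : ℕ} {c : ℕ → T}
    (hk : S.Ends h k c) : S.bordered.Ends h k (fun j => .inl (c j)) := by
  induction k generalizing c with
  | zero => exact hk
  | succ k ih =>
    obtain ⟨d, hd, hk⟩ := hk
    exact ⟨fun j => .inl (d j), ⟨isCol_bordered_inl.2 hd.1, hd.2⟩, ih hk⟩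

/-- New columns have no horizontal neighbours and never stand at both edges, so no complete picture
contains one. They become usable only next to a restart in `timed`. -/
theorem has_bordered {S : Dominoes T} {h m : ℕ} (hh : 0 < h) :
    S.bordered.Has h m ↔ S.Has h m := by
  constructor
  · rintro ⟨c, hc, hl, hk⟩
    cases h1 : c 0 with
    | inr b =>
      have hb := hl 0 hh
      rw [h1] at hb
      cases m with
      | zero =>
        have := hk 0 hh
        rw [h1] at this
        exact absurd (hb.symm.trans this) (by simp)
      | succ m =>
        obtain ⟨d, hd, -⟩ := hk
        have := hd.2 0 hh
        rw [h1] at this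
        exact this.elim
    | inl a =>
      obtain ⟨e, he, hde⟩ := exists_inl_of_isCol hh hc h1
      refine ⟨e, he, fun j hj => ?_, ends_of_bordered hh (ends_congr hde hk)⟩
      have := hl j hj
      rwa [hde j hj] at this
  · rintro ⟨c, hc, hl, hk⟩
    exact ⟨fun j => .inl (c j), isCol_bordered_inl.2 hc, hl, ends_bordered hk⟩

end Dominoes

/-! ### Timed walks which may be restarted -/

/-- A symbol `g`, a symbol `k` of a clock, and some flags: if `flag σ` is set in a column then the
column starts (`flag (!σ)`: ends) a picture. -/
structure Tile (G K : Type) where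
  g : G
  k : K
  flag : Bool → Bool
  color : Bool

instance {G K : Type} [Finite G] [Finite K] : Finite (Tile G K) :=
  Finite.of_injective (fun t : Tile G K => (t.g, t.k, t.flag, t.color)) (by
    rintro ⟨⟩ ⟨⟩ h
    simpa using h)

namespace Dominoes

variable {G K : Type}

/-- Walks of `S`, except that any column may be followed by a column that starts a picture, and any
column may be preceded by a column that ends one. A clock runs along. -/
def timed (σ : Bool) (S : Dominoes G) (R : Dominoes K) : Dominoes (Tile G K) where
  hor a b := a.color = b.color ∧ R.hor a.k b.k ∧ (b.flag σ = true → S.left b.g) ∧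
    (a.flag (!σ) = true → S.right a.g) ∧ (a.flag (!σ) = false → b.flag σ = false → S.hor a.g b.g)
  ver a b := S.ver a.g b.g ∧ R.ver a.k b.k ∧ a.flag = b.flag ∧ a.color = b.color
  left a := S.left a.g
  right a := S.right a.g
  bottom a := S.bottom a.g ∧ R.bottom a.k
  top a := S.top a.g ∧ R.top a.k

/-- Reflection exchanges starts and ends; the parameter `σ` makes the family closed under it, so
that every statement about the right side also serves the left side. -/
theorem timed_mirror (σ : Bool) (S : Dominoes G) (R : Dominoes K) :
    (timed σ S R).mirror = timed (!σ) S.mirror R.mirror := by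
  simp only [timed, mirror, Bool.not_not, Dominoes.mk.injEq, and_true]
  funext a b
  apply propext
  rw [eq_comm]
  tauto

variable {σ : Bool} {S : Dominoes G} {R : Dominoes K} {h : ℕ}

theorem IsCol.flag_eq {c : ℕ → Tile G K} (hc : (timed σ S R).IsCol h c) :
    ∀ j < h, (c j).flag = (c 0).flag := by
  intro j
  induction j with
  | zero => exact fun _ => rfl
  | succ j ih => exact fun hj => (hc.3 j hj).2.2.1.symm.trans (ih (by omega))

theorem IsCol.of_timed {c : ℕ → Tile G K} (hc : (timed σ S R).IsCol h c) :
    S.IsCol h (fun j => (c j).g) := ⟨hc.1.1, hc.2.1, fun j hj => (hc.3 j hj).1⟩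

/-- Follow the segment since the last start. At a column flagged as an end, the segment is a
picture; before a column flagged as a start, a new segment begins with `l = 0`; otherwise the
segment grows by a step of `S`. So restarts produce neither new heights nor narrower pictures. -/
theorem exists_has_of_timed_ends {l k : ℕ} {c : ℕ → Tile G K}
    (hc : (timed σ S R).IsCol h c) (hl : S.mirror.Ends h l (fun j => (c j).g))
    (hk : (timed σ S R).Ends h k c) : ∃ m ≤ l + k, S.Has h m := by
  induction k generalizing l c with
  | zero => exact ⟨l, le_rfl, has_of_ends (k := 0) hc.of_timed hl hk⟩
  | succ k ih =>
    obtain ⟨d, hd, hk⟩ := hk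
    cases h1 : (c 0).flag (!σ) with
    | true =>
      refine ⟨l, by omega, has_of_ends (k := 0) hc.of_timed hl fun j hj => ?_⟩
      exact (hd.2 j hj).2.2.2.1 (by rw [hc.flag_eq j hj, h1])
    | false =>
      cases h2 : (d 0).flag σ with
      | true =>
        obtain ⟨m, hm, hm'⟩ := ih (l := 0) hd.1
          (fun j hj => (hd.2 j hj).2.2.1 (by rw [hd.1.flag_eq j hj, h2])) hk
        exact ⟨m, by omega, hm'⟩
      | false =>
        obtain ⟨m, hm, hm'⟩ := ih (l := l + 1) hd.1 ⟨_, ⟨hc.of_timed.mirror, fun j hj =>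
          (hd.2 j hj).2.2.2.2 (by rw [hc.flag_eq j hj, h1])
            (by rw [hd.1.flag_eq j hj, h2])⟩, hl⟩ hk
        exact ⟨m, by omega, hm'⟩

theorem exists_has_of_timed_has {k : ℕ} (hk : (timed σ S R).Has h k) : ∃ m ≤ k, S.Has h m := by
  obtain ⟨c, hc, hl, hk⟩ := hk
  simpa using exists_has_of_timed_ends (l := 0) hc hl hk

/-- Replace the symbol and the flags. -/
def _root_.BlockGluing.Tile.setg (t : Tile G K) (σ : Bool) (g : G) (f : Bool) : Tile G K where
  g := g
  k := t.k
  flag := fun b => if b = σ then f else false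
  color := t.color

theorem IsCol.setg {c : ℕ → Tile G K} (hc : (timed σ S R).IsCol h c) {v : ℕ → G}
    (hv : S.IsCol h v) (f : Bool) :
    (timed σ S R).IsCol h (fun j => (c j).setg σ (v j) f) :=
  ⟨⟨hv.1, hc.1.2⟩, ⟨hv.2, hc.2.2⟩, fun j hj =>
    ⟨hv.3 j hj, (hc.3 j hj).2.1, rfl, (hc.3 j hj).2.2.2⟩⟩

theorem ends_setg {m k : ℕ} {c : ℕ → Tile G K} {v : ℕ → G} (hm : S.Ends h m v)
    (hk : (timed σ S R).Ends h k c) (hmk : m ≤ k) (f : Bool) :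
    (timed σ S R).Ends h m (fun j => (c j).setg σ (v j) f) := by
  induction m generalizing k c v f with
  | zero => exact hm
  | succ m ih =>
    obtain ⟨k, rfl⟩ : ∃ k', k = k' + 1 := ⟨k - 1, by omega⟩
    obtain ⟨u, hu, hm⟩ := hm
    obtain ⟨d, hd, hk⟩ := hk
    refine ⟨_, ⟨hd.1.setg hu.1 false, fun j hj => ?_⟩, ih hm hk (by omega) false⟩
    have := hd.2 j hj
    refine ⟨this.1, this.2.1, ?_, ?_, fun _ _ => hu.2 j hj⟩ <;> simp [Tile.setg]

/-- If the given walk is too long, its columns after `c` are overwritten by a picture of `m + 1`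
columns, the first one flagged as a start. Clock and colour are kept; stopping early is allowed
because the edge condition does not involve the clock. -/
theorem exists_timed_ends_le {m k : ℕ} {c : ℕ → Tile G K} (hm : S.Has h m)
    (hk : (timed σ S R).Ends h k c) : ∃ k' ≤ m + 1, (timed σ S R).Ends h k' c := by
  by_cases hmk : k ≤ m + 1
  · exact ⟨k, hmk, hk⟩
  obtain ⟨k, rfl⟩ : ∃ k', k = k' + 1 := ⟨k - 1, by omega⟩
  obtain ⟨v, hv, hl, hm⟩ := hm
  obtain ⟨d, hd, hk⟩ := hk
  refine ⟨m + 1, le_rfl, _, ⟨hd.1.setg hv true, fun j hj => ?_⟩, ends_setg hm hk (by omega) true⟩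
  have := hd.2 j hj
  exact ⟨this.1, this.2.1, fun _ => hl j hj, this.2.2.2.1, by simp [Tile.setg]⟩

/-- A column from which no step of `S` and no exit is possible is followed by a whole picture. -/
theorem exists_has_of_stuck {k : ℕ} {c : ℕ → Tile G K} (hh : 0 < h)
    (hr : ∀ j < h, ¬S.right (c j).g) (hs : ∀ j < h, ∀ b, ¬S.hor (c j).g b)
    (hk : (timed σ S R).Ends h k c) : ∃ m, m + 1 ≤ k ∧ S.Has h m := by
  cases k with
  | zero => exact (hr 0 hh (hk 0 hh)).elim
  | succ k =>
    obtain ⟨d, hd, hk⟩ := hk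
    -- Neither an end flag on `c` nor a step of `S` is possible, so the next column must be flagged
    -- as a start.
    have hl : ∀ j < h, S.left (d j).g := by
      intro j hj
      have := hd.2 j hj
      have h1 : (c j).flag (!σ) = false := by
        by_contra hcon
        exact hr j hj (this.2.2.2.1 (by simpa using hcon))
      apply this.2.2.1
      by_contra hcon
      exact hs j hj _ (this.2.2.2.2 h1 (by simpa using hcon))
    obtain ⟨m, hm, hm'⟩ := exists_has_of_timed_has ⟨d, hd.1, hl, hk⟩
    exact ⟨m, by omega, hm'⟩

/-- Every walk comes to an end. -/
def Terminates {T : Type} (S : Dominoes T) (h : ℕ) : Prop :=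
  WellFounded fun c' c : ℕ → T => S.IsCol h c ∧ S.Step h c c'

theorem Terminates.timed (hR : R.Terminates h) : (timed σ S R).Terminates h := by
  refine Subrelation.wf (r := InvImage _ fun c : ℕ → Tile G K => fun j => (c j).k) ?_
    (InvImage.wf _ hR)
  rintro c' c ⟨hc, hc', hs⟩
  exact ⟨⟨hc.1.2, hc.2.2, fun j hj => (hc.3 j hj).2.1⟩,
    ⟨hc'.1.2, hc'.2.2, fun j hj => (hc'.3 j hj).2.1⟩, fun j hj => (hs j hj).2.1⟩

/-! ### The clock -/

/-- Columns over `Q` increase strictly in the lexicographic order; the second component of a symbol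
says whether the row is below (`0`), at (`1`), or above (`2`) the first difference with the column
to the left. -/
def clock (Q : Type) [LinearOrder Q] : Dominoes (Q × Fin 3) where
  hor a b := (b.2 = 0 → a.1 = b.1) ∧ (b.2 = 1 → a.1 < b.1)
  ver a b := (a.2 = 0 ∧ b.2 ≠ 2) ∨ (a.2 ≠ 0 ∧ b.2 = 2)
  left _ := True
  right _ := True
  bottom a := a.2 ≠ 2
  top a := a.2 ≠ 0

variable {Q : Type} [LinearOrder Q]

/-- Read upwards, the markers of a valid column are `0…0 1 2…2`. -/
theorem exists_first_of_isCol_clock {c : ℕ → Q × Fin 3} (hh : 0 < h)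
    (hc : (clock Q).IsCol h c) : ∃ i < h, (∀ j < i, (c j).2 = 0) ∧ (c i).2 = 1 := by
  have hex : ∃ i, (c i).2 ≠ 0 := ⟨h - 1, hc.2⟩
  classical
  have hlt : Nat.find hex < h := lt_of_le_of_lt (Nat.find_min' hex hc.2) (by omega)
  have hz : ∀ j < Nat.find hex, (c j).2 = 0 := fun j hj => by simpa using Nat.find_min hex hj
  refine ⟨Nat.find hex, hlt, hz, ?_⟩
  have hne := Nat.find_spec hex
  have h2 : (c (Nat.find hex)).2 ≠ 2 := by
    cases hi : Nat.find hex with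
    | zero => exact hc.1
    | succ i =>
      have := hc.3 i (by omega)
      rcases this with this | this
      · exact this.2
      · exact (this.1 (hz i (by omega))).elim
  generalize (c (Nat.find hex)).2 = z at *
  fin_cases z <;> simp_all

theorem clock_terminates [Finite Q] (hh : 0 < h) : (clock Q).Terminates h := by
  let f : (ℕ → Q × Fin 3) → Lex (Fin h → Q) := fun c => toLex fun j => (c j).1
  have : Finite (Lex (Fin h → Q)) := inferInstanceAs (Finite (Fin h → Q))
  refine Subrelation.wf (r := InvImage (· > ·) f) ?_
    (InvImage.wf _ (Finite.to_wellFoundedGT (α := Lex (Fin h → Q))).wf)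
  rintro c' c ⟨-, hc', hs⟩
  obtain ⟨i, hi, hlt, h1⟩ := exists_first_of_isCol_clock hh hc'
  exact ⟨⟨i, hi⟩, fun j hj => (hs j j.2).1 (hlt j hj), (hs i hi).2 h1⟩

theorem clock_mirror_terminates [Finite Q] (hh : 0 < h) : (clock Q).mirror.Terminates h := by
  let f : (ℕ → Q × Fin 3) → Lex (Fin h → Q) := fun c => toLex fun j => (c j).1
  have : Finite (Lex (Fin h → Q)) := inferInstanceAs (Finite (Fin h → Q))
  refine Subrelation.wf (r := InvImage (· < ·) f) ?_
    (InvImage.wf _ (Finite.to_wellFoundedLT (α := Lex (Fin h → Q))).wf)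
  rintro c' c ⟨hc, -, hs⟩
  obtain ⟨i, hi, hlt, h1⟩ := exists_first_of_isCol_clock hh hc.mirror
  exact ⟨⟨i, hi⟩, fun j hj => (hs j j.2).1 (hlt j hj), (hs i hi).2 h1⟩

/-- The clock can run as long as there are columns. -/
theorem exists_clock_walk {N : ℕ} (hh : 0 < h) (u : ℕ → ℕ → Q)
    (hu : ∀ i i', i < i' → i' < N → ∃ j < h, u i j ≠ u i' j) :
    ∃ w : ℕ → ℕ → Q × Fin 3, ∀ i < N, (clock Q).IsCol h (w i) ∧
      ∀ i', i' + 1 = i → ∀ j < h, (clock Q).hor (w i' j) (w i j) := by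
  classical
  let f : ℕ → Lex (Fin h → Q) := fun i => toLex fun j => u i j
  have hinj : Set.InjOn f (Finset.range N) := by
    intro a ha b hb hab
    have hab' : ∀ j < h, u a j = u b j := fun j hj => congrFun (toLex_inj.1 hab) ⟨j, hj⟩
    simp only [Finset.coe_range, Set.mem_Iio] at ha hb
    rcases lt_trichotomy a b with hlt | heq | hlt
    · obtain ⟨j, hj, hne⟩ := hu a b hlt hb
      exact (hne (hab' j hj)).elim
    · exact heq
    · obtain ⟨j, hj, hne⟩ := hu b a hlt ha
      exact (hne (hab' j hj).symm).elim
  have hcard : ((Finset.range N).image f).card = N := by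
    rw [Finset.card_image_of_injOn hinj, Finset.card_range]
  -- The clock shows the given columns in sorted order, which need not be their order in the
  -- picture. Only their number matters.
  let e := Finset.orderEmbOfFin _ hcard
  let d : ℕ → Fin h → Q := fun i => if hi : i < N then ofLex (e ⟨i, hi⟩) else fun _ => u 0 0
  have hd : ∀ i, i + 1 < N → ∃ p : Fin h, (∀ j < p, d i j = d (i + 1) j) ∧ d i p < d (i + 1) p := by
    intro i hi
    have : e ⟨i, by omega⟩ < e ⟨i + 1, hi⟩ := e.strictMono (by simp [Fin.lt_def])
    obtain ⟨p, hp1, hp2⟩ := this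
    exact ⟨p, by simpa [d, hi, show i < N by omega] using hp1,
      by simpa [d, hi, show i < N by omega] using hp2⟩
  have hp : ∀ i, ∃ p : ℕ, p < h ∧ (∀ i', i' + 1 = i → i < N →
      (∀ j : Fin h, j < p → d i' j = d i j) ∧ ∀ j : Fin h, (j : ℕ) = p → d i' j < d i j) := by
    intro i
    by_cases hi : 0 < i ∧ i < N
    · obtain ⟨i, rfl⟩ : ∃ a, i = a + 1 := ⟨i - 1, by omega⟩
      obtain ⟨p, h1, h2⟩ := hd i hi.2
      refine ⟨p, p.2, fun i' hi' _ => ?_⟩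
      obtain rfl : i' = i := by omega
      refine ⟨h1, fun j hj => ?_⟩
      obtain rfl : j = p := Fin.ext hj
      exact h2
    -- The first column has no left neighbour to differ from, so its marker position is arbitrary.
    · exact ⟨0, hh, fun i' h1 h2 => (hi ⟨by omega, h2⟩).elim⟩
  choose p hp1 hp2 using hp
  refine ⟨fun i j => (if hj : j < h then d i ⟨j, hj⟩ else u 0 0,
    if j < p i then 0 else if j = p i then 1 else 2), fun i hi => ⟨⟨?_, ?_, ?_⟩, ?_⟩⟩
  · simp only [clock]
    split_ifs <;> (simp; try omega)
  · have := hp1 i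
    simp only [clock]
    split_ifs <;> (simp; try omega)
  · intro j hj
    simp only [clock]
    split_ifs <;> (simp; try omega)
  · intro i' hi' j hj
    have h1 := hp2 i i' hi' hi
    simp only [clock, hj, dif_pos]
    refine ⟨fun h0 => h1.1 ⟨j, hj⟩ ?_, fun h0 => h1.2 ⟨j, hj⟩ ?_⟩
    · split_ifs at h0 with ha hb <;> simp_all
    · split_ifs at h0 with ha hb <;> simp_all

end Dominoes

/-! ### The shift of broken pictures -/

/-- The configurations all of whose `2 × 2` windows satisfy `P` (lower left, lower right, upper
left, upper right). -/
def windowShift {C : Type} (P : C → C → C → C → Prop) : Set (ℤ × ℤ → C) :=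
  {x | ∀ i j, P (x (i, j)) (x (i + 1, j)) (x (i, j + 1)) (x (i + 1, j + 1))}

/-- A cell is blank, or a crack that runs up or down, or a tile that may be marked as the bottom
and as the top of its column. -/
inductive Cell (T : Type) where
  | blank
  | crack (up : Bool)
  | tile (t : T) (bot top : Bool)

instance {T : Type} [Finite T] : Finite (Cell T) :=
  Finite.of_injective (β := Option (Bool ⊕ T × Bool × Bool)) (fun
    | .blank => none
    | .crack u => some (.inl u)
    | .tile t b s => some (.inr (t, b, s))) (by
      rintro (_ | _ | _) (_ | _ | _) h <;> simp_all)

namespace Cell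

variable {T : Type}

def IsTile : Cell T → Prop
  | tile _ _ _ => True
  | _ => False

/-- The lower cell `a` and the upper cell `c` belong to the same column of tiles. -/
def Linked : Cell T → Cell T → Prop
  | tile _ _ s, tile _ b _ => s = false ∧ b = false
  | _, _ => False

@[simp] theorem isTile_tile (t : T) (b s : Bool) : (tile t b s).IsTile := trivial
@[simp] theorem not_isTile_blank : ¬(blank : Cell T).IsTile := id
@[simp] theorem not_isTile_crack (u : Bool) : ¬(crack u : Cell T).IsTile := id
@[simp] theorem linked_tile (t t' : T) (b s b' s' : Bool) :
    (tile t b s).Linked (tile t' b' s') ↔ s = false ∧ b' = false := Iff.rfl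
@[simp] theorem not_blank_linked (a : Cell T) : ¬blank.Linked a := by cases a <;> exact id
@[simp] theorem not_linked_blank (a : Cell T) : ¬a.Linked blank := by cases a <;> exact id
@[simp] theorem not_crack_linked (u : Bool) (a : Cell T) : ¬(crack u).Linked a := by
  cases a <;> exact id
@[simp] theorem not_linked_crack (u : Bool) (a : Cell T) : ¬a.Linked (crack u) := by
  cases a <;> exact id

theorem isTile_iff {a : Cell T} : a.IsTile ↔ ∃ t b s, a = tile t b s := by
  cases a <;> simp

theorem Linked.isTile_left {a c : Cell T} (h : a.Linked c) : a.IsTile := by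
  cases a <;> simp_all

theorem Linked.isTile_right {a c : Cell T} (h : a.Linked c) : c.IsTile := by
  cases c <;> simp_all

end Cell

open Cell

/-- The condition on the column `a`, `c` and its neighbour `b`, `d` on the side where `E` is the
edge condition: a column of tiles is continued, or ends in an edge, or ends along a crack that runs
to an end of the column which is not marked. -/
structure Side {T : Type} (E : T → Prop) (a b c d : Cell T) : Prop where
  link : a.Linked c → b.IsTile ∨ d.IsTile → b.Linked d
  edge : ∀ t bo tp, a = tile t bo tp → b.IsTile ∨ E t ∨ ∃ u, b = crack u
  up : ∀ t bo tp, a = tile t bo tp → b = crack true → tp = false ∧ (a.Linked c → d = crack true)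
  down : ∀ t bo tp, c = tile t bo tp → d = crack false →
    bo = false ∧ (a.Linked c → b = crack false)

/-- The local rule of broken pictures. -/
structure Window {T : Type} (S : Dominoes T) (a b c d : Cell T) : Prop where
  ends : ∀ t bo tp, a = tile t bo tp ∨ b = tile t bo tp →
    (bo = true → S.bottom t) ∧ (tp = true → S.top t)
  ver : ∀ t bo t' tp', (a = tile t bo false ∧ c = tile t' false tp') ∨
    (b = tile t bo false ∧ d = tile t' false tp') → S.ver t t'
  hor : ∀ t bo tp t' bo' tp', a = tile t bo tp → b = tile t' bo' tp' →
    S.hor t t' ∧ bo = bo' ∧ tp = tp'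
  sideR : Side S.right a b c d
  sideL : Side S.left b a d c

theorem Window.mirror {T : Type} {S : Dominoes T} {a b c d : Cell T} (h : Window S a b c d) :
    Window S.mirror b a d c where
  ends t bo tp ht := h.ends t bo tp ht.symm
  ver t bo t' tp' ht := h.ver t bo t' tp' ht.symm
  hor t bo tp t' bo' tp' h1 h2 := by
    obtain ⟨h1, h2, h3⟩ := h.hor _ _ _ _ _ _ h2 h1
    exact ⟨h1, h2.symm, h3.symm⟩
  sideR := h.sideL
  sideL := h.sideR

theorem window_blank {T : Type} (S : Dominoes T) : Window S blank blank blank blank := by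
  have hs : ∀ E : T → Prop, Side E blank blank blank blank := fun E => by constructor <;> simp
  exact ⟨by simp, by simp, by simp, hs _, hs _⟩

/-- The shift of broken pictures over `S`. -/
def brokenShift {T : Type} (S : Dominoes T) : Set (ℤ × ℤ → Cell T) := windowShift (Window S)

/-- Reflection of a configuration. -/
def reflect {C : Type} (x : ℤ × ℤ → C) : ℤ × ℤ → C := fun u => x (-u.1, u.2)

@[simp] theorem reflect_reflect {C : Type} (x : ℤ × ℤ → C) : reflect (reflect x) = x := by
  funext u; simp [reflect]

theorem reflect_mem {T : Type} {S : Dominoes T} {x : ℤ × ℤ → Cell T} (hx : x ∈ brokenShift S) :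
    reflect x ∈ brokenShift S.mirror := by
  intro i j
  have := (hx (-(i + 1)) j).mirror
  simpa [reflect] using this

/-- The cells `(i, r0), …, (i, r0 + h - 1)` are a whole column `c` of height `h`, marked at both
ends. -/
def IsRun {T : Type} (x : ℤ × ℤ → Cell T) (i r0 : ℤ) (h : ℕ) (c : ℕ → T) : Prop :=
  0 < h ∧ ∀ j < h, x (i, r0 + j) = tile (c j) (j == 0) (j + 1 == h)

variable {T : Type} {S : Dominoes T} {x : ℤ × ℤ → Cell T} {i r0 : ℤ} {h : ℕ} {c : ℕ → T}

theorem IsRun.reflect (hr : IsRun x i r0 h c) : IsRun (reflect x) (-i) r0 h c :=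
  ⟨hr.1, fun j hj => by simpa [BlockGluing.reflect] using hr.2 j hj⟩

theorem IsRun.succ (hr : IsRun x i r0 h c) {j : ℕ} (hj : j + 1 < h) :
    x (i, r0 + j + 1) = tile (c (j + 1)) false (j + 1 + 1 == h) := by
  have := hr.2 (j + 1) hj
  push_cast at this
  rw [add_assoc, this]

theorem IsRun.linked (hr : IsRun x i r0 h c) {j : ℕ} (hj : j + 1 < h) :
    (x (i, r0 + j)).Linked (x (i, r0 + j + 1)) := by
  rw [hr.2 j (by omega), hr.succ hj]
  simpa using hj.ne

theorem IsRun.isCol (hx : x ∈ brokenShift S) (hr : IsRun x i r0 h c) : S.IsCol h c := by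
  refine ⟨?_, ?_, fun j hj => ?_⟩
  · exact ((hx i (r0 + (0 : ℕ))).ends _ _ _ (.inl (hr.2 0 hr.1))).1 rfl
  · have h1 := hr.1
    refine ((hx i (r0 + (h - 1 : ℕ))).ends _ _ _ (.inl (hr.2 (h - 1) (by omega)))).2 ?_
    simp
    omega
  · refine (hx i (r0 + j)).ver (c j) (j == 0) _ _ (.inl ⟨?_, hr.succ hj⟩)
    · rw [hr.2 j (by omega), show (j + 1 == h) = false by simp; omega]

theorem forall_lt_of_iff_succ {P : ℕ → Prop} {h j0 : ℕ} (hP : ∀ j, j + 1 < h → (P j ↔ P (j + 1)))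
    (hj0 : j0 < h) (h0 : P j0) : ∀ j < h, P j := by
  have key : ∀ j < h, (P 0 ↔ P j) := by
    intro j
    induction j with
    | zero => simp
    | succ j ih => exact fun hj => (ih (by omega)).trans (hP j hj)
  exact fun j hj => (key j hj).1 ((key j0 hj0).2 h0)

/-- The rows of the run are linked, so its neighbours are tiles in all rows or in none. In the
second case a crack would propagate to the end it runs to, where the mark forbids it; hence every
row is at the edge. -/
theorem IsRun.step (hx : x ∈ brokenShift S) (hr : IsRun x i r0 h c) :
    (∀ j < h, S.right (c j)) ∨ ∃ c', IsRun x (i + 1) r0 h c' ∧ ∀ j < h, S.hor (c j) (c' j) := by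
  by_cases hex : ∃ j < h, (x (i + 1, r0 + j)).IsTile
  · right
    obtain ⟨j0, hj0, h0⟩ := hex
    have hall : ∀ j < h, (x (i + 1, r0 + j)).IsTile := by
      refine forall_lt_of_iff_succ (P := fun j => (x (i + 1, r0 + j)).IsTile) ?_ hj0 h0
      intro j hj
      have := (hx i (r0 + j)).sideR.link (hr.linked hj)
      rw [add_assoc r0] at this
      push_cast
      exact ⟨fun ht => (this (.inl ht)).isTile_right, fun ht => (this (.inr ht)).isTile_left⟩
    simp only [isTile_iff] at hall
    have : Nonempty T := ⟨c 0⟩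
    choose! c' bo tp hc' using hall
    have hhor := fun j (hj : j < h) => (hx i (r0 + j)).hor _ _ _ _ _ _ (hr.2 j hj) (hc' j hj)
    exact ⟨c', ⟨hr.1, fun j hj => by rw [hc' j hj, (hhor j hj).2.1, (hhor j hj).2.2]⟩,
      fun j hj => (hhor j hj).1⟩
  · left
    push Not at hex
    intro j hj
    have hup : ∀ m j, j + m + 1 = h → x (i + 1, r0 + j) ≠ crack true := by
      intro m
      induction m with
      | zero =>
        intro j hj hcon
        have := ((hx i (r0 + j)).sideR.up _ _ _ (hr.2 j (by omega)) hcon).1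
        simp at this
        omega
      | succ m ih =>
        intro j hj hcon
        have := ((hx i (r0 + j)).sideR.up _ _ _ (hr.2 j (by omega)) hcon).2
          (hr.linked (by omega))
        apply ih (j + 1) (by omega)
        push_cast
        rwa [← add_assoc]
    have hdown : ∀ j < h, x (i + 1, r0 + j) ≠ crack false := by
      intro j
      induction j with
      | zero =>
        intro hj hcon
        -- The rule for downward cracks concerns the upper cells of a window, so the bottom row is
        -- tested in the window one row lower.
        have := ((hx i (r0 - 1)).sideR.down (c 0) true (0 + 1 == h) ?_ ?_).1
        · simp at this
        · simpa using hr.2 0 hj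
        · simpa using hcon
      | succ j ih =>
        intro hj hcon
        refine ih (by omega) (((hx i (r0 + j)).sideR.down _ _ _ (hr.succ hj) ?_).2 (hr.linked hj))
        rw [← hcon]
        push_cast
        rw [add_assoc]
    rcases (hx i (r0 + j)).sideR.edge _ _ _ (hr.2 j hj) with h1 | h1 | ⟨u, h1⟩
    · exact (hex j hj h1).elim
    · exact h1
    · cases u with
      | true => exact (hup (h - 1 - j) j (by omega) h1).elim
      | false => exact (hdown j hj h1).elim

/-- Termination turns the local continuation rule into an edge at finite distance. -/
theorem IsRun.exists_ends (hx : x ∈ brokenShift S) (hS : ∀ h, 0 < h → S.Terminates h)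
    (hr : IsRun x i r0 h c) : ∃ k, S.Ends h k c ∧ ∀ e : ℕ, e ≤ k → (x (i + e, r0)).IsTile := by
  have h0 : ∀ {i c}, IsRun x i r0 h c → (x (i, r0)).IsTile := fun hr => by
    have := hr.2 0 hr.1
    simp only [Nat.cast_zero, add_zero] at this
    simp [this]
  induction c using (hS h hr.1).induction generalizing i with
  | _ c ih =>
    rcases hr.step hx with h1 | ⟨c', hr', h1⟩
    · refine ⟨0, h1, fun e he => ?_⟩
      obtain rfl : e = 0 := by omega
      simpa using h0 hr
    · obtain ⟨k, hk, hk'⟩ := ih c' ⟨hr.isCol hx, hr'.isCol hx, h1⟩ hr'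
      refine ⟨k + 1, ⟨c', ⟨hr'.isCol hx, h1⟩, hk⟩, fun e he => ?_⟩
      cases e with
      | zero => simpa using h0 hr
      | succ e =>
        have := hk' e (by omega)
        push_cast
        rwa [show i + ((e : ℤ) + 1) = i + 1 + e by ring]

/-! ### Cutting and pasting -/

/-- Keep only the rows `0, …, n - 1`. -/
def strip (n : ℤ) (x : ℤ × ℤ → Cell T) : ℤ × ℤ → Cell T :=
  fun u => if 0 ≤ u.2 ∧ u.2 < n then x u else blank

theorem Side.cut_above {E : T → Prop} {a b c d : Cell T} (hs : Side E a b c d) :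
    Side E a b blank blank :=
  ⟨by simp, hs.edge, fun t bo tp h1 h2 => ⟨(hs.up t bo tp h1 h2).1, by simp⟩, by simp⟩

theorem Side.cut_below {E : T → Prop} {a b c d : Cell T} (hs : Side E a b c d) :
    Side E blank blank c d :=
  ⟨by simp, by simp, by simp, fun t bo tp h1 h2 => ⟨(hs.down t bo tp h1 h2).1, by simp⟩⟩

/-- Cutting rows away is harmless because the rule never requires the end of a column of tiles to be
marked. -/
theorem strip_mem (hx : x ∈ brokenShift S) (n : ℤ) : strip n x ∈ brokenShift S := by
  intro i j
  have hw := hx i j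
  by_cases h1 : 0 ≤ j ∧ j < n <;> by_cases h2 : 0 ≤ j + 1 ∧ j + 1 < n <;>
    simp only [strip, h1, h2, if_true, if_false, and_self]
  · exact hw
  · exact ⟨hw.ends, by simp, hw.hor, hw.sideR.cut_above, hw.sideL.cut_above⟩
  · exact ⟨by simp, by simp, by simp, hw.sideR.cut_below, hw.sideL.cut_below⟩
  · exact window_blank S

/-- Every window lies weakly on one side of column `m`, so agreement on a single column suffices.
This is the `+ 1` in the gap `2s + 1`. -/
theorem windowShift_mergeH {C : Type} {P : C → C → C → C → Prop} {x y : ℤ × ℤ → C}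
    (hx : x ∈ windowShift P) (hy : y ∈ windowShift P) {m : ℤ} (hm : ∀ j, x (m, j) = y (m, j)) :
    (fun u => if u.1 ≤ m then x u else y u) ∈ windowShift P := by
  intro i j
  rcases lt_trichotomy i m with h1 | rfl | h1
  · have := hx i j
    simpa [h1.le, show i + 1 ≤ m by omega] using this
  · have := hy i j
    simpa [hm] using this
  · have := hy i j
    simpa [h1, show ¬i ≤ m by omega, show ¬i + 1 ≤ m by omega] using this

theorem windowShift_mergeV {C : Type} {P : C → C → C → C → Prop} {x y : ℤ × ℤ → C}
    (hx : x ∈ windowShift P) (hy : y ∈ windowShift P) {m : ℤ} (hm : ∀ i, x (i, m) = y (i, m)) :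
    (fun u => if u.2 ≤ m then x u else y u) ∈ windowShift P := by
  intro i j
  rcases lt_trichotomy j m with h1 | rfl | h1
  · have := hx i j
    simpa [h1.le, show j + 1 ≤ m by omega] using this
  · have := hy i j
    simpa [hm] using this
  · have := hy i j
    simpa [h1, show ¬j ≤ m by omega, show ¬j + 1 ≤ m by omega] using this

theorem windowShift_translate {C : Type} {P : C → C → C → C → Prop} {x : ℤ × ℤ → C}
    (hx : x ∈ windowShift P) (a b : ℤ) : (fun u => x (u.1 + a, u.2 + b)) ∈ windowShift P := by
  intro i j
  have := hx (i + a) (j + b)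
  simpa only [add_right_comm] using this

/-! ### Closing a configuration on one side -/

/-- The marks delimit a run: an end of one run strictly inside the other would be both marked and
unmarked. -/
theorem IsRun.eq_of_overlap {N r0 r0' : ℤ} {h h' : ℕ} {c c' : ℕ → T} {j j' : ℕ}
    (hr : IsRun x N r0 h c) (hr' : IsRun x N r0' h' c') (hj : j < h) (hj' : j' < h')
    (hjj : r0 + j = r0' + j') : r0 = r0' ∧ h = h' := by
  have low : ∀ {r0 r0' : ℤ} {h h' : ℕ} {c c' : ℕ → T} {j j' : ℕ}, IsRun x N r0 h c →
      IsRun x N r0' h' c' → j < h → j' < h' → r0 + j = r0' + j' → r0' ≤ r0 := by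
    intro r0 r0' h h' c c' j j' hr hr' hj hj' hjj
    by_contra! hlt
    obtain ⟨d, hd⟩ := Int.le.dest hlt.le
    have h1 := hr.2 d (by omega)
    have h2 := hr'.2 0 hr'.1
    rw [hd] at h1
    rw [Nat.cast_zero, add_zero, h1] at h2
    simp at h2
    omega
  have high : ∀ {r0 : ℤ} {h h' : ℕ} {c c' : ℕ → T}, IsRun x N r0 h c →
      IsRun x N r0 h' c' → h' ≤ h := by
    intro r0 h h' c c' hr hr'
    by_contra! hlt
    have h0 := hr.1
    have h1 := hr.2 (h - 1) (by omega)
    have h2 := hr'.2 (h - 1) (by omega)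
    rw [h1] at h2
    simp at h2
    omega
  obtain rfl : r0 = r0' := le_antisymm (low hr' hr hj' hj hjj.symm) (low hr hr' hj hj' hjj)
  exact ⟨rfl, le_antisymm (high hr' hr) (high hr hr')⟩

/-- The cell `(N, r)` belongs to a column that is marked at both ends. -/
def InRun (x : ℤ × ℤ → Cell T) (N r : ℤ) : Prop :=
  ∃ (r0 : ℤ) (h : ℕ) (c : ℕ → T) (j : ℕ), IsRun x N r0 h c ∧ j < h ∧ r = r0 + j

/-- The cell `(N, r)` belongs to a column that is marked at its upper end. -/
def IsCapped (x : ℤ × ℤ → Cell T) (N r : ℤ) : Prop :=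
  ∃ m : ℕ, (∀ a < m, (x (N, r + a)).Linked (x (N, r + a + 1))) ∧
    ∃ t b, x (N, r + m) = tile t b true

theorem IsCapped.of_linked {N r : ℤ} (hl : (x (N, r)).Linked (x (N, r + 1)))
    (hc : IsCapped x N (r + 1)) : IsCapped x N r := by
  obtain ⟨m, h1, t, b, h2⟩ := hc
  refine ⟨m + 1, fun a ha => ?_, t, b, ?_⟩
  · cases a with
    | zero => simpa using hl
    | succ a =>
      have := h1 a (by omega)
      push_cast
      rwa [show r + ((a : ℤ) + 1) = r + 1 + a by ring]
  · push_cast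
    rwa [show r + ((m : ℤ) + 1) = r + 1 + m by ring]

theorem IsCapped.inRun {N r : ℤ} {t : T} {b : Bool} (ht : x (N, r) = tile t true b)
    (hc : IsCapped x N r) : InRun x N r := by
  obtain ⟨m, h1, t', b', h2⟩ := hc
  have key : ∀ a : ℕ, a < m + 1 → ∃ t, x (N, r + a) = tile t (a == 0) (a + 1 == m + 1) := by
    intro a ha
    have hb : ∀ t bo tp, x (N, r + a) = tile t bo tp → bo = (a == 0) := by
      intro t1 bo tp h3
      cases a with
      | zero => simp_all
      | succ a =>
        have := h1 a (by omega)
        push_cast at h3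
        rw [← add_assoc] at h3
        rw [h3] at this
        cases hx : x (N, r + a) <;> simp_all
    have ht : ∀ t bo tp, x (N, r + a) = tile t bo tp → tp = (a + 1 == m + 1) := by
      intro t1 bo tp h3
      by_cases ham : a = m
      · subst ham
        simp_all
      · have := h1 a (by omega)
        rw [h3] at this
        cases hx : x (N, r + a + 1) <;> simp_all
    have hT : (x (N, r + a)).IsTile := by
      by_cases ham : a = m
      · subst ham
        simp [h2]
      · exact (h1 a (by omega)).isTile_left
    obtain ⟨t1, bo, tp, h3⟩ := isTile_iff.1 hT
    exact ⟨t1, by rw [h3, hb _ _ _ h3, ht _ _ _ h3]⟩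
  have : Nonempty T := ⟨t⟩
  choose! c hc using key
  exact ⟨r, m + 1, c, 0, ⟨by omega, hc⟩, by omega, by simp⟩

theorem InRun.linked_iff {N r : ℤ} (hl : (x (N, r)).Linked (x (N, r + 1))) :
    InRun x N r ↔ InRun x N (r + 1) := by
  constructor
  · rintro ⟨r0, h, c, j, hr, hj, rfl⟩
    have hjh : j + 1 < h := by
      rw [hr.2 j hj] at hl
      by_contra hcon
      cases hx : x (N, r0 + j + 1) <;> simp_all
      omega
    exact ⟨r0, h, c, j + 1, hr, hjh, by push_cast; ring⟩
  · rintro ⟨r0, h, c, j, hr, hj, hrj⟩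
    cases j with
    | zero =>
      have := hr.2 0 hr.1
      rw [← hrj] at this
      rw [this] at hl
      cases hx : x (N, r) <;> simp_all
    | succ j => exact ⟨r0, h, c, j, hr, by omega, by push_cast at hrj; omega⟩

/-- The rows of the continuation to the right of the column `N`: whole columns are continued by
walks `w`, other columns end along a crack. -/
theorem exists_continuation (x : ℤ × ℤ → Cell T) (N : ℤ) (k : ℤ → ℕ → ℕ)
    (w : ℤ → ℕ → ℕ → ℕ → T)
    (hw : ∀ r0 h, (∃ c, IsRun x N r0 h c) → IsRun x N r0 h (w r0 h 0)) :
    ∃ F : ℤ → ℕ → Cell T, (∀ r, F r 0 = x (N, r)) ∧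
      (∀ r0 h, (∃ c, IsRun x N r0 h c) → ∀ j < h, ∀ i, F (r0 + j) i =
        if i ≤ k r0 h then tile (w r0 h i j) (j == 0) (j + 1 == h) else blank) ∧
      (∀ r, ¬InRun x N r → (x (N, r)).IsTile →
        (F r 1 = crack true ∧ ¬IsCapped x N r) ∨ (F r 1 = crack false ∧ IsCapped x N r)) ∧
      (∀ r i, ¬InRun x N r → F r (i + 2) = blank) ∧
      (∀ r i, ¬(x (N, r)).IsTile → F r (i + 1) = blank) := by
  classical
  have key : ∀ r, ∃ f : ℕ → Cell T, f 0 = x (N, r) ∧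
      (∀ r0 h, (∃ c, IsRun x N r0 h c) → ∀ j < h, r = r0 + j → ∀ i, f i =
        if i ≤ k r0 h then tile (w r0 h i j) (j == 0) (j + 1 == h) else blank) ∧
      (¬InRun x N r → (x (N, r)).IsTile →
        (f 1 = crack true ∧ ¬IsCapped x N r) ∨ (f 1 = crack false ∧ IsCapped x N r)) ∧
      (∀ i, ¬InRun x N r → f (i + 2) = blank) ∧
      (∀ i, ¬(x (N, r)).IsTile → f (i + 1) = blank) := by
    intro r
    by_cases hr : InRun x N r
    · have hr' := hr
      obtain ⟨r0, h, c, j, hrun, hj, hrj⟩ := hr'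
      have hw0 := (hw r0 h ⟨c, hrun⟩).2 j hj
      refine ⟨fun i => if i ≤ k r0 h then tile (w r0 h i j) (j == 0) (j + 1 == h) else blank,
        by simp [hrj, hw0], ?_, fun hn => (hn hr).elim, fun i hn => (hn hr).elim, fun i hn => ?_⟩
      · rintro r0' h' ⟨c', hrun'⟩ j' hj' hrj' i
        obtain ⟨rfl, rfl⟩ := hrun.eq_of_overlap hrun' hj hj' (hrj.symm.trans hrj')
        obtain rfl : j = j' := by omega
        rfl
      · rw [hrj, hw0] at hn
        simp at hn
    -- A column that is not whole but has its top mark lacks a bottom mark, so its crack may run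
    -- down; without a top mark the crack may run up.
    · refine ⟨fun i => if i = 0 then x (N, r) else if i = 1 ∧ (x (N, r)).IsTile then
        (if IsCapped x N r then crack false else crack true) else blank, by simp, ?_, ?_, ?_, ?_⟩
      · rintro r0 h ⟨c, hrun⟩ j hj hrj
        exact (hr ⟨r0, h, c, j, hrun, hj, hrj⟩).elim
      · intro _ ht
        by_cases hc : IsCapped x N r <;> simp [ht, hc]
      · simp
      · intro i ht
        simp [ht]
  choose F h0 h1 h2 h3 h4 using key
  exact ⟨F, h0, fun r0 h hr j hj i => h1 _ r0 h hr j hj rfl i, h2, fun r i => h3 r i,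
    fun r i => h4 r i⟩

/-- Whole columns follow their short walks; all others are closed by one column of cracks, whence `1
≤ s`. The last conclusion keeps blank rows blank, so that the other side can be closed afterwards
within the same rows. -/
theorem exists_closed_right [Nonempty T] (hx : x ∈ brokenShift S) (N : ℤ) {s : ℕ} (hs : 1 ≤ s)
    (hshort : ∀ r0 h c, IsRun x N r0 h c → ∃ k ≤ s, S.Ends h k c) :
    ∃ y ∈ brokenShift S, (∀ i j, i ≤ N → y (i, j) = x (i, j)) ∧
      (∀ i j, N + s < i → y (i, j) = blank) ∧
      (∀ i j, N < i → x (N, j) = blank → y (i, j) = blank) := by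
  have hwalk : ∀ r0 h, ∃ (k : ℕ) (w : ℕ → ℕ → T), (∃ c, IsRun x N r0 h c) →
      k ≤ s ∧ IsRun x N r0 h (w 0) ∧ (∀ i < k, S.Step h (w i) (w (i + 1))) ∧
      ∀ j < h, S.right (w k j) := by
    intro r0 h
    by_cases hr : ∃ c, IsRun x N r0 h c
    · obtain ⟨c, hr⟩ := hr
      obtain ⟨k, hk, hE⟩ := hshort r0 h c hr
      obtain ⟨w, rfl, h1, h2⟩ := Dominoes.exists_walk hE
      exact ⟨k, w, fun _ => ⟨hk, hr, h1, h2⟩⟩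
    · exact ⟨0, fun _ _ => Classical.arbitrary T, fun h => (hr h).elim⟩
  choose k w hwalk using hwalk
  have hcol : ∀ r0 h, (∃ c, IsRun x N r0 h c) → ∀ i ≤ k r0 h, S.IsCol h (w r0 h i) := by
    intro r0 h hr i hi
    obtain ⟨-, h1, h2, -⟩ := hwalk r0 h hr
    cases i with
    | zero => exact h1.isCol hx
    | succ i => exact (h2 i hi).1
  obtain ⟨F, hF0, hrun, hcrack, hout, hblank⟩ :=
    exists_continuation x N k w fun r0 h hr => (hwalk r0 h hr).2.1
  have hcases : ∀ r i t bo tp, F r i = tile t bo tp → i = 0 ∨ InRun x N r := by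
    intro r i t bo tp ht
    by_contra! hcon
    obtain ⟨i, rfl⟩ := Nat.exists_eq_succ_of_ne_zero hcon.1
    cases i with
    | zero =>
      by_cases hT : (x (N, r)).IsTile
      · rcases hcrack r hcon.2 hT with h1 | h1 <;> simp_all
      · simp_all
    | succ i => simp_all
  -- The marks at the ends of a run block links across them, so two linked cells of which one
  -- continues a run continue the same run.
  have hlink : ∀ r i, (F r i).Linked (F (r + 1) i) → InRun x N r ∨ InRun x N (r + 1) →
      ∃ r0 h j, (∃ c, IsRun x N r0 h c) ∧ r = r0 + (j : ℕ) ∧ j + 1 < h ∧ i ≤ k r0 h := by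
    intro r i hl hr
    rcases hr with ⟨r0, h, c, j, hr, hj, rfl⟩ | ⟨r0, h, c, j, hr, hj, hrj⟩
    · have h1 := hrun r0 h ⟨c, hr⟩ j hj i
      split_ifs at h1 with hi
      · refine ⟨r0, h, j, ⟨c, hr⟩, rfl, ?_, hi⟩
        rw [h1] at hl
        by_contra hcon
        cases hd : F (r0 + j + 1) i <;> simp_all
        omega
      · simp_all
    · have h1 := hrun r0 h ⟨c, hr⟩ j hj i
      rw [← hrj] at h1
      split_ifs at h1 with hi
      · cases j with
        | zero =>
          rw [h1] at hl
          cases hd : F r i <;> simp_all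
        | succ j =>
          exact ⟨r0, h, j, ⟨c, hr⟩, by push_cast at hrj; omega, hj, hi⟩
      · simp_all
  have hrun' : ∀ r0 h, (∃ c, IsRun x N r0 h c) → ∀ j, j + 1 < h → ∀ i, F (r0 + j + 1) i =
      if i ≤ k r0 h then tile (w r0 h i (j + 1)) false (j + 1 + 1 == h) else blank := by
    intro r0 h hr j hj i
    have := hrun r0 h hr (j + 1) hj i
    push_cast at this
    rwa [add_assoc]
  have hends : ∀ r i t bo tp, F r i = tile t bo tp →
      (bo = true → S.bottom t) ∧ (tp = true → S.top t) := by
    intro r i t bo tp ht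
    rcases hcases r i t bo tp ht with rfl | ⟨r0, h, c, j, hr, hj, rfl⟩
    · rw [hF0] at ht
      exact (hx N r).ends t bo tp (.inl ht)
    · rw [hrun r0 h ⟨c, hr⟩ j hj i] at ht
      split_ifs at ht with hi
      have hc := hcol r0 h ⟨c, hr⟩ i hi
      simp only [tile.injEq] at ht
      obtain ⟨rfl, rfl, rfl⟩ := ht
      refine ⟨fun h0 => ?_, fun h0 => ?_⟩
      · obtain rfl : j = 0 := by simpa using h0
        exact hc.1
      · obtain rfl : j = h - 1 := by simp at h0; omega
        exact hc.2
  have hver : ∀ r i t bo t' tp', F r i = tile t bo false → F (r + 1) i = tile t' false tp' →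
      S.ver t t' := by
    intro r i t bo t' tp' h1 h2
    rcases hcases r i t bo _ h1 with rfl | hr
    · rw [hF0] at h1 h2
      exact (hx N r).ver t bo t' tp' (.inl ⟨h1, h2⟩)
    · obtain ⟨r0, h, j, hr', rfl, hj, hi⟩ := hlink r i (by simp [h1, h2]) (.inl hr)
      rw [hrun r0 h hr' j (by omega), if_pos hi] at h1
      rw [hrun' r0 h hr' j hj, if_pos hi] at h2
      simp only [tile.injEq] at h1 h2
      rw [← h1.1, ← h2.1]
      exact (hcol r0 h hr' i hi).3 j hj
  have hwin : ∀ r i, Window S (F r i) (F r (i + 1)) (F (r + 1) i) (F (r + 1) (i + 1)) := by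
    intro r i
    have hcr : ∀ u, F r (i + 1) = crack u → i = 0 ∧ ¬InRun x N r := by
      intro u hu
      by_cases hr : InRun x N r
      · obtain ⟨r0, h, c, j, hr, hj, rfl⟩ := hr
        rw [hrun r0 h ⟨c, hr⟩ j hj] at hu
        split_ifs at hu
      · refine ⟨?_, hr⟩
        cases i with
        | zero => rfl
        | succ i => rw [hout r i hr] at hu; cases hu
    have hcr' : ∀ u, F (r + 1) (i + 1) = crack u → i = 0 ∧ ¬InRun x N (r + 1) := by
      intro u hu
      by_cases hr : InRun x N (r + 1)
      · obtain ⟨r0, h, c, j, hr, hj, hrj⟩ := hr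
        rw [hrj, hrun r0 h ⟨c, hr⟩ j hj] at hu
        split_ifs at hu
      · refine ⟨?_, hr⟩
        cases i with
        | zero => rfl
        | succ i => rw [hout _ i hr] at hu; cases hu
    refine ⟨?_, ?_, ?_, ⟨?_, ?_, ?_, ?_⟩, ⟨?_, ?_, ?_, ?_⟩⟩
    · rintro t bo tp (h1 | h1) <;> exact hends _ _ _ _ _ h1
    · rintro t bo t' tp' (⟨h1, h2⟩ | ⟨h1, h2⟩) <;> exact hver _ _ _ _ _ _ h1 h2
    · intro t bo tp t' bo' tp' h1 h2
      obtain ⟨r0, h, c, j, hr, hj, rfl⟩ := (hcases _ _ _ _ _ h2).resolve_left (by omega)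
      rw [hrun r0 h ⟨c, hr⟩ j hj] at h1 h2
      split_ifs at h1 h2 with hi hi'
      simp only [tile.injEq] at h1 h2
      obtain ⟨rfl, rfl, rfl⟩ := h1
      obtain ⟨rfl, rfl, rfl⟩ := h2
      exact ⟨((hwalk r0 h ⟨c, hr⟩).2.2.1 i hi').2 j hj, rfl, rfl⟩
    · intro hl ht
      have hr : InRun x N r ∨ InRun x N (r + 1) := by
        rcases ht with ht | ht
        · obtain ⟨t, b, p, ht⟩ := isTile_iff.1 ht
          exact .inl ((hcases _ _ _ _ _ ht).resolve_left (by omega))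
        · obtain ⟨t, b, p, ht⟩ := isTile_iff.1 ht
          exact .inr ((hcases _ _ _ _ _ ht).resolve_left (by omega))
      obtain ⟨r0, h, j, hr', rfl, hj, hi⟩ := hlink r i hl hr
      rw [hrun r0 h hr' j (by omega), hrun' r0 h hr' j hj] at ht ⊢
      split_ifs at ht ⊢
      · simp
        omega
      · simp at ht
    · intro t bo tp ht
      by_cases hr : InRun x N r
      · obtain ⟨r0, h, c, j, hr, hj, rfl⟩ := hr
        rw [hrun r0 h ⟨c, hr⟩ j hj] at ht ⊢
        split_ifs at ht with hi
        by_cases hi' : i + 1 ≤ k r0 h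
        · simp [hi']
        · obtain rfl : i = k r0 h := by omega
          simp only [tile.injEq] at ht
          rw [← ht.1]
          exact .inr (.inl ((hwalk r0 h ⟨c, hr⟩).2.2.2 j hj))
      · obtain rfl := (hcases _ _ _ _ _ ht).resolve_right hr
        rw [hF0] at ht
        rcases hcrack r hr (by simp [ht]) with h1 | h1
        · exact .inr (.inr ⟨_, h1.1⟩)
        · exact .inr (.inr ⟨_, h1.1⟩)
    · intro t bo tp ht hu
      obtain ⟨rfl, hr⟩ := hcr _ hu
      simp only [hF0] at ht ⊢
      rcases hcrack r hr (by simp [ht]) with h1 | h1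
      · refine ⟨?_, fun hl => ?_⟩
        · by_contra hcon
          -- A tile with a top mark is capped by itself.
          exact h1.2 ⟨0, by simp, t, bo, by simpa [ht] using hcon⟩
        · rcases hcrack (r + 1) (mt (InRun.linked_iff hl).2 hr) hl.isTile_right with h2 | h2
          · exact h2.1
          · exact (h1.2 (h2.2.of_linked hl)).elim
      · exact absurd (h1.1.symm.trans hu) (by simp)
    · intro t bo tp ht hu
      obtain ⟨rfl, hr⟩ := hcr' _ hu
      simp only [hF0] at ht ⊢
      rcases hcrack (r + 1) hr (by simp [ht]) with h1 | h1
      · exact absurd (h1.1.symm.trans hu) (by simp)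
      · refine ⟨?_, fun hl => ?_⟩
        · by_contra hcon
          obtain rfl : bo = true := by simpa using hcon
          exact hr (h1.2.inRun ht)
        · rcases hcrack r (mt (InRun.linked_iff hl).1 hr) hl.isTile_left with h2 | h2
          · exact (h2.2 (h1.2.of_linked hl)).elim
          · exact h2.1
    · intro hl _
      obtain ⟨t, b, p, ht⟩ := isTile_iff.1 hl.isTile_left
      obtain ⟨r0, h, j, hr, rfl, hj, hi⟩ :=
        hlink r (i + 1) hl (.inl ((hcases _ _ _ _ _ ht).resolve_left (by omega)))
      rw [hrun r0 h hr j (by omega), hrun' r0 h hr j hj, if_pos (by omega), if_pos (by omega)]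
      simp
      omega
    · intro t bo tp ht
      obtain ⟨r0, h, c, j, hr, hj, rfl⟩ := (hcases _ _ _ _ _ ht).resolve_left (by omega)
      rw [hrun r0 h ⟨c, hr⟩ j hj] at ht ⊢
      split_ifs at ht
      rw [if_pos (by omega)]
      simp
    · intro t bo tp ht hu
      obtain ⟨r0, h, c, j, hr, hj, rfl⟩ := (hcases _ _ _ _ _ ht).resolve_left (by omega)
      rw [hrun r0 h ⟨c, hr⟩ j hj] at hu
      split_ifs at hu
    · intro t bo tp ht hu
      obtain ⟨r0, h, c, j, hr, hj, hrj⟩ := (hcases _ _ _ _ _ ht).resolve_left (by omega)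
      rw [hrj, hrun r0 h ⟨c, hr⟩ j hj] at hu
      split_ifs at hu
  refine ⟨fun u => if u.1 ≤ N then x u else F u.2 (u.1 - N).toNat, ?_, ?_, ?_, ?_⟩
  · intro i j
    rcases lt_or_ge i N with hi | hi
    · simpa [hi.le, show i + 1 ≤ N by omega] using hx i j
    · obtain ⟨d, rfl⟩ := Int.le.dest hi
      have := hwin j d
      have hd : ∀ r, (if d = 0 then x (N + d, r) else F r d) = F r d := by
        intro r
        cases d with
        | zero => simp [hF0]
        | succ d => rw [if_neg (by omega)]
      simpa [show ¬N + d + 1 ≤ N by omega, hd, show (N + d + 1 - N).toNat = d + 1 by omega]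
  · intro i j hi
    simp [hi]
  · intro i j hi
    obtain ⟨d, rfl⟩ := Int.le.dest hi.le
    have hd : 1 ≤ d := by omega
    simp only [show ¬N + s + d ≤ N by omega, if_false,
      show (N + s + d - N).toNat = s + d by omega]
    by_cases hr : InRun x N j
    · obtain ⟨r0, h, c, j, hr, hj, rfl⟩ := hr
      have := (hwalk r0 h ⟨c, hr⟩).1
      rw [hrun r0 h ⟨c, hr⟩ j hj, if_neg (by omega)]
    · obtain ⟨e, he⟩ : ∃ e, s + d = e + 2 := ⟨s + d - 2, by omega⟩
      rw [he, hout j e hr]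
  · intro i j hi hb
    simp only [show ¬i ≤ N by omega, if_false]
    obtain ⟨e, he⟩ : ∃ e, (i - N).toNat = e + 1 := ⟨(i - N).toNat - 1, by omega⟩
    rw [he, hblank j e (by simp [hb])]

/-! ### Confining a pattern to a box -/

theorem IsRun.exists_mirror_ends (hx : x ∈ brokenShift S)
    (hS : ∀ h, 0 < h → S.mirror.Terminates h) {i r0 : ℤ} {h : ℕ} {c : ℕ → T}
    (hr : IsRun x i r0 h c) :
    ∃ k, S.mirror.Ends h k c ∧ ∀ e : ℕ, e ≤ k → (x (i - e, r0)).IsTile := by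
  obtain ⟨k, h1, h2⟩ := hr.reflect.exists_ends (reflect_mem hx) hS
  refine ⟨k, h1, fun e he => ?_⟩
  have := h2 e he
  simp only [BlockGluing.reflect] at this
  rwa [show -(-i + (e : ℤ)) = i - e by ring] at this

theorem IsRun.height_le {n : ℕ} (hb : ∀ i j, ¬(0 ≤ j ∧ j < (n : ℤ)) → x (i, j) = blank)
    {i r0 : ℤ} {h : ℕ} {c : ℕ → T} (hr : IsRun x i r0 h c) : h ≤ n := by
  have h0 := hr.1
  have h1 := hr.2 0 h0
  have h2 := hr.2 (h - 1) (by omega)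
  by_contra! hcon
  by_cases hr0 : 0 ≤ r0
  · rw [hb _ _ (by omega)] at h2
    cases h2
  · rw [hb _ _ (by simp; omega)] at h1
    cases h1

theorem exists_confined [Nonempty T] (hS : ∀ h, 0 < h → S.Terminates h)
    (hS' : ∀ h, 0 < h → S.mirror.Terminates h) {n s : ℕ} (hs : 1 ≤ s)
    (hshort : ∀ h c, 0 < h → h ≤ n → S.IsCol h c → (∃ l, S.mirror.Ends h l c) →
      (∃ k, S.Ends h k c) → (∃ k ≤ s, S.Ends h k c) ∧ ∃ l ≤ s, S.mirror.Ends h l c)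
    (hx : x ∈ brokenShift S) :
    ∃ y ∈ brokenShift S, (∀ i j : ℤ, 0 ≤ i → i < n → 0 ≤ j → j < n → y (i, j) = x (i, j)) ∧
      ∀ i j : ℤ, i < -s ∨ n + s ≤ i ∨ j < 0 ∨ n ≤ j → y (i, j) = blank := by
  -- Stated for every `z` because it serves both the stripped configuration and the one already
  -- closed on the right. Blank outer rows bound the heights of runs by `n`.
  have key : ∀ z ∈ brokenShift S, (∀ i j, ¬(0 ≤ j ∧ j < (n : ℤ)) → z (i, j) = blank) →
      ∀ i r0 h c, IsRun z i r0 h c →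
      (∃ k ≤ s, S.Ends h k c) ∧ ∃ l ≤ s, S.mirror.Ends h l c := by
    intro z hz hb i r0 h c hr
    obtain ⟨l, hl, -⟩ := hr.exists_mirror_ends hz hS'
    obtain ⟨k, hk, -⟩ := hr.exists_ends hz hS
    exact hshort h c hr.1 (hr.height_le hb) (hr.isCol hz) ⟨l, hl⟩ ⟨k, hk⟩
  have hz := strip_mem hx (n : ℤ)
  have hzb : ∀ i j, ¬(0 ≤ j ∧ j < (n : ℤ)) → strip (n : ℤ) x (i, j) = blank :=
    fun i j hj => by rw [strip, if_neg hj]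
  obtain ⟨y, hy, hy1, hy2, hy3⟩ := exists_closed_right hz (n - 1) hs
    fun r0 h c hr => (key _ hz hzb _ _ _ _ hr).1
  have hyb : ∀ i j, ¬(0 ≤ j ∧ j < (n : ℤ)) → y (i, j) = blank := by
    intro i j hj
    rcases le_or_gt i (n - 1 : ℤ) with hi | hi
    · rw [hy1 i j hi, hzb i j hj]
    · exact hy3 i j hi (hzb _ j hj)
  obtain ⟨u, hu, hu1, hu2, hu3⟩ := exists_closed_right (reflect_mem hy) 0 hs
    fun r0 h c hr => (key y hy hyb _ _ _ _ (by simpa using hr.reflect)).2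
  refine ⟨reflect u, reflect_mem hu, fun i j hi hi' hj hj' => ?_, fun i j hij => ?_⟩
  · simp only [reflect]
    rw [hu1 _ _ (by omega)]
    simp only [reflect, neg_neg]
    rw [hy1 _ _ (by omega), strip, if_pos ⟨hj, hj'⟩]
  · simp only [reflect]
    have hb : ∀ i', (i' < -(s : ℤ) ∨ n + s ≤ i' ∨ j < 0 ∨ n ≤ j) → -s ≤ i' →
        y (i', j) = blank := by
      intro i' h1 h2
      rcases h1 with h1 | h1 | h1
      · omega
      · exact hy2 _ _ (by omega)
      · exact hyb _ _ (by omega)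
    by_cases hi : i < -s
    · exact hu2 _ _ (by omega)
    by_cases hi' : 0 ≤ i
    · rw [hu1 _ _ (by omega)]
      simp only [reflect, neg_neg]
      exact hb i hij (by omega)
    · refine hu3 _ _ (by omega) ?_
      simp only [reflect, neg_zero]
      exact hb 0 (by omega) (by omega)

/-- The first box is blank from column `n + s` on; the translate of the second is blank up to and
including that column, since `2 * s + 1 ≤ k`. Vertically the boxes do not grow, and row `n` is blank
in both. -/
theorem exists_glued [Nonempty T] (hS : ∀ h, 0 < h → S.Terminates h)
    (hS' : ∀ h, 0 < h → S.mirror.Terminates h) {n s k : ℕ} (hs : 1 ≤ s)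
    (hshort : ∀ h c, 0 < h → h ≤ n → S.IsCol h c → (∃ l, S.mirror.Ends h l c) →
      (∃ k, S.Ends h k c) → (∃ k ≤ s, S.Ends h k c) ∧ ∃ l ≤ s, S.mirror.Ends h l c)
    (hk : 2 * s + 1 ≤ k) {y : ℤ × ℤ → Cell T}
    (hx : x ∈ brokenShift S) (hy : y ∈ brokenShift S) :
    (∃ z ∈ brokenShift S, ∀ i j : ℤ, 0 ≤ i → i < n → 0 ≤ j → j < n →
      z (i, j) = x (i, j) ∧ z (i + (n + k), j) = y (i, j)) ∧
    ∃ z ∈ brokenShift S, ∀ i j : ℤ, 0 ≤ i → i < n → 0 ≤ j → j < n →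
      z (i, j) = x (i, j) ∧ z (i, j + (n + k)) = y (i, j) := by
  obtain ⟨x', hx', hx1, hx2⟩ := exists_confined hS hS' hs hshort hx
  obtain ⟨y', hy', hy1, hy2⟩ := exists_confined hS hS' hs hshort hy
  constructor
  · refine ⟨_, windowShift_mergeH hx' (windowShift_translate hy' (-(n + k)) 0) (m := n + s)
      fun j => ?_, fun i j hi hi' hj hj' => ⟨?_, ?_⟩⟩
    · rw [hx2 _ _ (by omega)]
      exact (hy2 _ _ (by omega)).symm
    · simp only [show i ≤ (n : ℤ) + s by omega, if_true]
      exact hx1 i j hi hi' hj hj'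
    · simp only [show ¬i + (n + k) ≤ (n : ℤ) + s by omega, if_false, add_zero,
        add_neg_cancel_right]
      exact hy1 i j hi hi' hj hj'
  · refine ⟨_, windowShift_mergeV hx' (windowShift_translate hy' 0 (-(n + k))) (m := n)
      fun j => ?_, fun i j hi hi' hj hj' => ⟨?_, ?_⟩⟩
    · rw [hx2 _ _ (by omega)]
      exact (hy2 _ _ (by omega)).symm
    · simp only [show j ≤ (n : ℤ) by omega, if_true]
      exact hx1 i j hi hi' hj hj'
    · simp only [show ¬j + (n + k) ≤ (n : ℤ) by omega, if_false, add_zero,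
        add_neg_cancel_right]
      exact hy1 i j hi hi' hj hj'

/-! ### A single picture on a blank background -/

/-- A picture of height `h` and width `m + 1` on a blank background. -/
def rect (w : ℕ → ℕ → T) (m h : ℕ) : ℤ × ℤ → Cell T := fun u =>
  if (0 ≤ u.1 ∧ u.1 ≤ m) ∧ 0 ≤ u.2 ∧ u.2 < h then
    tile (w u.1.toNat u.2.toNat) (u.2.toNat == 0) (u.2.toNat + 1 == h)
  else blank

theorem rect_apply {w : ℕ → ℕ → T} {m h a b : ℕ} (ha : a ≤ m) (hb : b < h) :
    rect w m h (a, b) = tile (w a b) (b == 0) (b + 1 == h) := by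
  simp [rect, ha, hb]

theorem rect_cases (w : ℕ → ℕ → T) (m h : ℕ) (i j : ℤ) :
    (∃ a b : ℕ, i = a ∧ j = b ∧ a ≤ m ∧ b < h) ∨ rect w m h (i, j) = blank := by
  by_cases hij : (0 ≤ i ∧ i ≤ m) ∧ 0 ≤ j ∧ j < h
  · exact .inl ⟨i.toNat, j.toNat, by omega, by omega, by omega, by omega⟩
  · exact .inr (by rw [rect, if_neg hij])

theorem rect_eq_tile {w : ℕ → ℕ → T} {m h : ℕ} {i j : ℤ} {t : T} {bo tp : Bool}
    (ht : rect w m h (i, j) = tile t bo tp) :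
    ∃ a b : ℕ, i = a ∧ j = b ∧ a ≤ m ∧ b < h ∧ t = w a b ∧ bo = (b == 0) ∧ tp = (b + 1 == h) := by
  rcases rect_cases w m h i j with ⟨a, b, rfl, rfl, ha, hb⟩ | h1
  · rw [rect_apply ha hb, tile.injEq] at ht
    exact ⟨a, b, rfl, rfl, ha, hb, ht.1.symm, ht.2.1.symm, ht.2.2.symm⟩
  · rw [h1] at ht
    cases ht

theorem rect_isTile {w : ℕ → ℕ → T} {m h : ℕ} {i j : ℤ} :
    (rect w m h (i, j)).IsTile ↔ (0 ≤ i ∧ i ≤ m) ∧ 0 ≤ j ∧ j < h := by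
  rw [rect]
  split_ifs with hij <;> simpa using hij

theorem rect_linked {w : ℕ → ℕ → T} {m h : ℕ} {i j : ℤ} :
    (rect w m h (i, j)).Linked (rect w m h (i, j + 1)) ↔
      (0 ≤ i ∧ i ≤ m) ∧ 0 ≤ j ∧ j + 1 < h := by
  constructor
  · intro hl
    have h1 := rect_isTile.1 hl.isTile_left
    have h2 := rect_isTile.1 hl.isTile_right
    omega
  · intro hij
    rw [rect, rect, if_pos (by simp; omega), if_pos (by simp; omega), linked_tile]
    simp
    omega

theorem rect_ne_crack {w : ℕ → ℕ → T} {m h : ℕ} {u : ℤ × ℤ} {b : Bool} :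
    rect w m h u ≠ crack b := by
  rw [rect]
  split_ifs <;> simp

theorem rect_mem {w : ℕ → ℕ → T} {m h : ℕ} (hc : ∀ i ≤ m, S.IsCol h (w i))
    (hl : ∀ j < h, S.left (w 0 j)) (hr : ∀ j < h, S.right (w m j))
    (hs : ∀ i < m, ∀ j < h, S.hor (w i j) (w (i + 1) j)) : rect w m h ∈ brokenShift S := by
  have hends : ∀ i j t bo tp, rect w m h (i, j) = tile t bo tp →
      (bo = true → S.bottom t) ∧ (tp = true → S.top t) := by
    intro i j t bo tp ht
    obtain ⟨a, b, rfl, rfl, ha, hb, rfl, rfl, rfl⟩ := rect_eq_tile ht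
    refine ⟨fun h0 => ?_, fun h0 => ?_⟩
    · obtain rfl : b = 0 := by simpa using h0
      exact (hc a ha).1
    · obtain rfl : b = h - 1 := by simp at h0; omega
      exact (hc a ha).2
  have hver : ∀ i j t bo tp t' bo' tp', rect w m h (i, j) = tile t bo tp →
      rect w m h (i, j + 1) = tile t' bo' tp' → S.ver t t' := by
    intro i j t bo tp t' bo' tp' h1 h2
    obtain ⟨a, b, rfl, rfl, ha, hb, rfl, -, -⟩ := rect_eq_tile h1
    obtain ⟨a', b', ha1, hb1, -, hb', rfl, -, -⟩ := rect_eq_tile h2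
    obtain rfl : a' = a := by omega
    obtain rfl : b' = b + 1 := by omega
    exact (hc _ ha).3 b hb'
  intro i j
  refine ⟨?_, ?_, ?_, ⟨?_, ?_, ?_, ?_⟩, ⟨?_, ?_, ?_, ?_⟩⟩
  · rintro t bo tp (h1 | h1) <;> exact hends _ _ _ _ _ h1
  · rintro t bo t' tp' (⟨h1, h2⟩ | ⟨h1, h2⟩) <;> exact hver _ _ _ _ _ _ _ _ h1 h2
  · intro t bo tp t' bo' tp' h1 h2
    obtain ⟨a, b, rfl, rfl, ha, hb, rfl, rfl, rfl⟩ := rect_eq_tile h1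
    obtain ⟨a', b', ha1, hb1, ha', -, rfl, rfl, rfl⟩ := rect_eq_tile h2
    obtain rfl : a' = a + 1 := by omega
    obtain rfl : b' = b := by omega
    exact ⟨hs a ha' _ hb, rfl, rfl⟩
  · rw [rect_linked, rect_linked, rect_isTile, rect_isTile]
    omega
  · intro t bo tp h1
    obtain ⟨a, b, rfl, rfl, ha, hb, rfl, rfl, rfl⟩ := rect_eq_tile h1
    rw [rect_isTile]
    rcases ha.lt_or_eq with h2 | rfl
    · left; omega
    · exact .inr (.inl (hr b hb))
  · exact fun t bo tp _ h2 => (rect_ne_crack h2).elim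
  · exact fun t bo tp _ h2 => (rect_ne_crack h2).elim
  · rw [rect_linked, rect_linked, rect_isTile, rect_isTile]
    omega
  · intro t bo tp h1
    obtain ⟨a, b, ha0, rfl, ha, hb, rfl, rfl, rfl⟩ := rect_eq_tile h1
    rw [rect_isTile]
    cases a with
    | zero => exact .inr (.inl (hl b hb))
    | succ a => left; push_cast at ha0; omega
  · exact fun t bo tp _ h2 => (rect_ne_crack h2).elim
  · exact fun t bo tp _ h2 => (rect_ne_crack h2).elim

/-! ### Gluing distances in the shift of broken timed pictures -/

namespace Dominoes

variable {G : Type}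

/-- The domino system whose broken pictures have the wanted gluing distances. -/
abbrev glueing (D : Dominoes G) (Q : Type) [LinearOrder Q] :
    Dominoes (Tile (G ⊕ Bool) (Q × Fin 3)) := timed true D.bordered (clock Q)

variable {D : Dominoes G} {Q : Type} [LinearOrder Q]

theorem glueing_mirror :
    (D.glueing Q).mirror = timed false D.bordered.mirror (clock Q).mirror := by
  rw [glueing, timed_mirror]
  rfl

theorem glueing_terminates [Finite Q] {h : ℕ} (hh : 0 < h) : (D.glueing Q).Terminates h :=
  (clock_terminates hh).timed

theorem glueing_mirror_terminates [Finite Q] {h : ℕ} (hh : 0 < h) :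
    (D.glueing Q).mirror.Terminates h := by
  rw [glueing_mirror]
  exact (clock_mirror_terminates hh).timed

/-- The two given walks form a complete timed picture, so some picture of height `h` exists. Then
`hD` supplies a narrow one, with which both walks can be restarted. -/
theorem glueing_short {n s : ℕ}
    (hD : ∀ h m, 0 < h → h ≤ n → D.Has h m → ∃ m', m' + 1 ≤ s ∧ D.Has h m') (h : ℕ)
    (c : ℕ → Tile (G ⊕ Bool) (Q × Fin 3)) (hh : 0 < h) (hn : h ≤ n)
    (hc : (D.glueing Q).IsCol h c) (hl : ∃ l, (D.glueing Q).mirror.Ends h l c)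
    (hk : ∃ k, (D.glueing Q).Ends h k c) :
    (∃ k ≤ s, (D.glueing Q).Ends h k c) ∧ ∃ l ≤ s, (D.glueing Q).mirror.Ends h l c := by
  obtain ⟨l, hl⟩ := hl
  obtain ⟨k, hk⟩ := hk
  obtain ⟨m0, -, hm0⟩ := exists_has_of_timed_has (has_of_ends hc hl hk)
  obtain ⟨m, hms, hm⟩ := hD h m0 hh hn ((has_bordered hh).1 hm0)
  have hm' := (has_bordered hh).2 hm
  obtain ⟨k', hk', hk⟩ := exists_timed_ends_le hm' hk
  rw [glueing_mirror] at hl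
  obtain ⟨l', hl', hl⟩ := exists_timed_ends_le hm'.mirror hl
  rw [← glueing_mirror] at hl
  exact ⟨⟨k', by omega, hk⟩, l', by omega, hl⟩

/-- A minimal picture together with its two border columns has `m + 3` pairwise distinct columns, so
a clock over an alphabet containing a copy of `G ⊕ Bool` lasts long enough. -/
theorem exists_glueing_picture {h m : ℕ} (hh : 0 < h) (hm : D.Has h m)
    (hmin : ∀ m', D.Has h m' → m ≤ m') (e : G ⊕ Bool → Q) (he : Function.Injective e)
    (color : Bool) : ∃ w : ℕ → ℕ → Tile (G ⊕ Bool) (Q × Fin 3),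
      (∀ i j, (w i j).color = color) ∧ (∀ j, (w 0 j).g = .inr false) ∧
      (∀ j, (w (m + 2) j).g = .inr true) ∧ (∀ i ≤ m + 2, (D.glueing Q).IsCol h (w i)) ∧
      ∀ i < m + 2, ∀ j < h, (D.glueing Q).hor (w i j) (w (i + 1) j) := by
  obtain ⟨v, hv0, hvl, hvs, hvr, hinj⟩ := exists_injective_walk hm hmin
  let u : ℕ → ℕ → G ⊕ Bool := fun i j =>
    if i = 0 then .inr false else if i ≤ m + 1 then .inl (v (i - 1) j) else .inr true
  have hu : ∀ i i', i < i' → i' < m + 3 → ∃ j < h, e (u i j) ≠ e (u i' j) := by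
    intro i i' hi hi'
    simp only [he.ne_iff, u]
    by_cases h0 : i = 0
    · refine ⟨0, hh, ?_⟩
      rw [if_pos h0, if_neg (by omega)]
      split_ifs <;> simp
    by_cases h1 : i' ≤ m + 1
    · obtain ⟨j, hj, hne⟩ := hinj (i - 1) (i' - 1) (by omega) (by omega)
      refine ⟨j, hj, ?_⟩
      simpa [h0, h1, show i' ≠ 0 by omega, show i ≤ m + 1 by omega] using hne
    · refine ⟨0, hh, ?_⟩
      simp [h0, h1, show i' ≠ 0 by omega, show i ≤ m + 1 by omega]
  obtain ⟨w, hw⟩ := exists_clock_walk hh (fun i j => e (u i j)) hu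
  have hvc := fun i hi => (mirror_ends_of_walk hv0 hvl hvs i hi).1
  -- Column 1 is flagged as a start and column `m + 1` as an end; this excuses the steps from and to
  -- the border columns from the horizontal rule of `bordered`.
  refine ⟨fun i j => ⟨u i j, w i j, fun b => if b then i == 1 else i == m + 1, color⟩,
    fun _ _ => rfl, fun _ => rfl, fun j => by simp [u], fun i hi => ?_, fun i hi j hj => ?_⟩
  · have hcol : D.bordered.IsCol h (u i) := by
      by_cases h0 : i = 0
      · have : u i = fun _ => .inr false := by funext j; simp [u, h0]
        rw [this]
        exact isCol_bordered_inr D h false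
      by_cases h1 : i ≤ m + 1
      · have : u i = fun j => .inl (v (i - 1) j) := by funext j; simp [u, h0, h1]
        rw [this]
        exact isCol_bordered_inl.2 (hvc _ (by omega))
      · have : u i = fun _ => .inr true := by funext j; simp [u, h0, h1]
        rw [this]
        exact isCol_bordered_inr D h true
    have hclock := (hw i (by omega)).1
    exact ⟨⟨hcol.1, hclock.1⟩, ⟨hcol.2, hclock.2⟩,
      fun j hj => ⟨hcol.3 j hj, hclock.3 j hj, rfl, rfl⟩⟩
  · refine ⟨rfl, (hw (i + 1) (by omega)).2 i rfl j hj, ?_, ?_, ?_⟩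
    · intro h1
      obtain rfl : i = 0 := by simpa using h1
      simpa [u, Dominoes.bordered] using hvl j hj
    · intro h1
      obtain rfl : i = m + 1 := by simpa using h1
      simpa [u, Dominoes.bordered] using hvr j hj
    · intro h1 h2
      simp only [Bool.not_true, Bool.false_eq_true, if_false, if_true, beq_eq_false_iff_ne] at h1 h2
      obtain ⟨i, rfl⟩ : ∃ i', i = i' + 1 := ⟨i - 1, by omega⟩
      have := (hvs i (by omega)).2 j hj
      simpa [u, Dominoes.bordered, show i ≤ m by omega, show i + 1 ≤ m by omega] using this

end Dominoes

variable {G : Type} {D : Dominoes G} {Q : Type} [LinearOrder Q]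

theorem color_eq_of_tiles {K : Type} {σ : Bool} {S : Dominoes G} {R : Dominoes K}
    {x : ℤ × ℤ → Cell (Tile G K)} (hx : x ∈ brokenShift (Dominoes.timed σ S R)) {a j : ℤ} {d : ℕ}
    (ht : ∀ e : ℕ, e ≤ d → (x (a + e, j)).IsTile) {t t' : Tile G K} {b s b' s' : Bool}
    (h0 : x (a, j) = tile t b s) (hd : x (a + d, j) = tile t' b' s') : t.color = t'.color := by
  induction d generalizing t' b' s' with
  | zero =>
    rw [Nat.cast_zero, add_zero, h0, tile.injEq] at hd
    rw [hd.1]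
  | succ d ih =>
    obtain ⟨u, bu, su, hu⟩ := isTile_iff.1 (ht d (by omega))
    refine (ih (fun e he => ht e (by omega)) hu).trans ?_
    push_cast at hd
    rw [← add_assoc] at hd
    exact ((hx _ j).hor _ _ _ _ _ _ hu hd).1.1

/-- A gluing distance of the shift is bounded below in terms of the width of the pictures. -/
theorem lt_of_glued [Finite Q] {h m : ℕ} (hh : 0 < h) (hm : D.Has h m)
    (hmin : ∀ m', D.Has h m' → m ≤ m') (e : G ⊕ Bool → Q) (he : Function.Injective e)
    {n k : ℕ} (hn : 1 ≤ n)
    (hglue : ∀ x ∈ brokenShift (D.glueing Q), ∀ y ∈ brokenShift (D.glueing Q),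
      ∃ z ∈ brokenShift (D.glueing Q), ∀ i j : ℤ, 0 ≤ i → i < n → 0 ≤ j → j < n →
        z (i, j) = x (i, j) ∧ z (i + (n + k), j) = y (i, j)) :
    1 ≤ k ∧ (h ≤ n → 2 * (m + 1) + 1 ≤ k) := by
  have hx : ∀ color, ∃ w : ℕ → ℕ → Tile (G ⊕ Bool) (Q × Fin 3),
      (∀ i j, (w i j).color = color) ∧ (∀ j, (w 0 j).g = .inr false) ∧
      (∀ j, (w (m + 2) j).g = .inr true) ∧ rect w (m + 2) h ∈ brokenShift (D.glueing Q) := by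
    intro color
    obtain ⟨w, h1, h2, h3, h4, h5⟩ := Dominoes.exists_glueing_picture hh hm hmin e he color
    refine ⟨w, h1, h2, h3, rect_mem h4 (fun j _ => ?_) (fun j _ => ?_) h5⟩
    · change D.bordered.left (w 0 j).g
      rw [h2]
      rfl
    · change D.bordered.right (w (m + 2) j).g
      rw [h3]
      rfl
  obtain ⟨w, hcw, hw0, -, hw⟩ := hx false
  obtain ⟨w', hcw', -, hw', hw2⟩ := hx true
  -- The first picture is placed with its first column in the last column of its pattern, the second
  -- with its last column in the first column of its pattern.
  obtain ⟨z, hz, hzz⟩ := hglue _ (windowShift_translate hw (-(n - 1)) 0) _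
    (windowShift_translate hw2 (m + 2 : ℕ) 0)
  have hp : ∀ j : ℕ, j < h → j < n →
      z (n - 1, j) = tile (w 0 j) (j == 0) (j + 1 == h) := by
    intro j hj hjn
    rw [(hzz (n - 1) j (by omega) (by omega) (by omega) (by omega)).1,
      ← rect_apply (Nat.zero_le (m + 2)) hj]
    congr 2
    simp
  have hq : ∀ j : ℕ, j < h → j < n →
      z (n + k, j) = tile (w' (m + 2) j) (j == 0) (j + 1 == h) := by
    intro j hj hjn
    have := (hzz 0 j (by omega) (by omega) (by omega) (by omega)).2
    rw [zero_add] at this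
    rw [this, ← rect_apply le_rfl hj]
    congr 2
    simp
  -- An unbroken row of tiles has one colour, but the two pictures have different colours.
  have hne : ¬∀ e : ℕ, e ≤ k + 1 → (z (n - 1 + e, (0 : ℕ))).IsTile := by
    intro ht
    have := color_eq_of_tiles hz ht (hp 0 hh hn)
      (by rw [← hq 0 hh hn]; congr 2; push_cast; ring)
    rw [hcw, hcw'] at this
    cases this
  have hp0 : (z (n - 1, (0 : ℕ))).IsTile := by rw [hp 0 hh hn]; trivial
  have hq0 : (z (n + k, (0 : ℕ))).IsTile := by rw [hq 0 hh hn]; trivial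
  constructor
  -- With gap 0 the two tiles in row 0 are adjacent. This needs no bound on `h`, so it also covers
  -- sizes `n` below all heights in the language.
  · by_contra hk
    refine hne fun e he => ?_
    obtain rfl | rfl : e = 0 ∨ e = 1 := by omega
    · simpa using hp0
    · convert hq0 using 3
      omega
  · intro hhn
    have hr : IsRun z (n - 1) (0 : ℕ) h (w 0) :=
      ⟨hh, fun j hj => by simpa using hp j hj (by omega)⟩
    have hr' : IsRun z (n + k) (0 : ℕ) h (w' (m + 2)) :=
      ⟨hh, fun j hj => by simpa using hq j hj (by omega)⟩
    obtain ⟨a, ha, hat⟩ := hr.exists_ends hz fun _ => Dominoes.glueing_terminates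
    obtain ⟨b, hb, hbt⟩ := hr'.exists_mirror_ends hz fun _ => Dominoes.glueing_mirror_terminates
    obtain ⟨ma, hma, hma'⟩ := Dominoes.exists_has_of_stuck hh
      (fun j _ => by rw [hw0]; simp [Dominoes.bordered])
      (fun j _ b => by rw [hw0]; simp [Dominoes.bordered]) ha
    rw [Dominoes.glueing_mirror] at hb
    obtain ⟨mb, hmb, hmb'⟩ := Dominoes.exists_has_of_stuck hh
      (fun j _ => by rw [hw']; simp [Dominoes.bordered, Dominoes.mirror])
      (fun j _ b => by rw [hw']; cases b <;> simp [Dominoes.bordered, Dominoes.mirror]) hb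
    have h1 := hmin _ ((Dominoes.has_bordered hh).1 hma')
    have h2 := hmin _ ((Dominoes.has_bordered hh).1 hmb'.mirror)
    by_contra hk
    refine hne fun e he => ?_
    -- Both `a` and `b` are at least `m + 1`, so for `k ≤ 2 * (m + 1)` the tiles reached from the
    -- two sides fill the row.
    by_cases hea : e ≤ a
    · exact hat e hea
    · have := hbt (k + 1 - e) (by omega)
      convert this using 3
      omega

/-! ### Gluing in terms of configurations -/

variable {C C' : Type}

/-- `GluesH` in terms of configurations instead of patterns. -/
def GlueableH (X : Set (ℤ × ℤ → C)) (n k : ℕ) : Prop :=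
  ∀ x ∈ X, ∀ y ∈ X, ∃ z ∈ X, ∀ i j : ℤ, 0 ≤ i → i < n → 0 ≤ j → j < n →
    z (i, j) = x (i, j) ∧ z (i + (n + k), j) = y (i, j)

/-- `GluesV` in terms of configurations instead of patterns. -/
def GlueableV (X : Set (ℤ × ℤ → C)) (n k : ℕ) : Prop :=
  ∀ x ∈ X, ∀ y ∈ X, ∃ z ∈ X, ∀ i j : ℤ, 0 ≤ i → i < n → 0 ≤ j → j < n →
    z (i, j) = x (i, j) ∧ z (i, j + (n + k)) = y (i, j)

theorem mem_square {n : ℕ} {i j : ℤ} :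
    (i, j) ∈ square n ↔ (0 ≤ i ∧ i < n) ∧ 0 ≤ j ∧ j < n := by
  simp [square]

theorem gluesH_iff {X : Set (ℤ × ℤ → C)} {n k : ℕ} : GluesH X n k ↔ GlueableH X n k := by
  constructor
  · intro hg x hx y hy
    obtain ⟨z, ⟨hz, hp⟩, w, hw, hwz⟩ := hg (fun u => x u) ⟨x, hx, fun _ => rfl⟩ (fun u => y u)
      ⟨y, hy, fun _ => rfl⟩
    refine ⟨z, hz, fun i j hi hi' hj hj' => ?_⟩
    have hu := mem_square.2 ⟨⟨hi, hi'⟩, hj, hj'⟩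
    refine ⟨hp ⟨_, hu⟩, ?_⟩
    have hwy : w (i, j) = y (i, j) := hw ⟨_, hu⟩
    rw [← hwz, ← hwy]
    simp [shift, -neg_add_rev]
  · rintro hg p ⟨x, hx, hp⟩ q ⟨y, hy, hq⟩
    obtain ⟨z, hz, hzz⟩ := hg x hx y hy
    refine ⟨z, ⟨hz, ?_⟩, fun u => z (u.1 + (n + k), u.2), ?_, ?_⟩
    · rintro ⟨⟨i, j⟩, hu⟩
      obtain ⟨⟨hi, hi'⟩, hj, hj'⟩ := mem_square.1 hu
      exact (hzz i j hi hi' hj hj').1.trans (hp ⟨_, hu⟩)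
    · rintro ⟨⟨i, j⟩, hu⟩
      obtain ⟨⟨hi, hi'⟩, hj, hj'⟩ := mem_square.1 hu
      exact (hzz i j hi hi' hj hj').2.trans (hq ⟨_, hu⟩)
    · funext u
      simp [shift, -neg_add_rev]

theorem gluesV_iff {X : Set (ℤ × ℤ → C)} {n k : ℕ} : GluesV X n k ↔ GlueableV X n k := by
  constructor
  · intro hg x hx y hy
    obtain ⟨z, ⟨hz, hp⟩, w, hw, hwz⟩ := hg (fun u => x u) ⟨x, hx, fun _ => rfl⟩ (fun u => y u)
      ⟨y, hy, fun _ => rfl⟩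
    refine ⟨z, hz, fun i j hi hi' hj hj' => ?_⟩
    have hu := mem_square.2 ⟨⟨hi, hi'⟩, hj, hj'⟩
    refine ⟨hp ⟨_, hu⟩, ?_⟩
    have hwy : w (i, j) = y (i, j) := hw ⟨_, hu⟩
    rw [← hwz, ← hwy]
    simp [shift, -neg_add_rev]
  · rintro hg p ⟨x, hx, hp⟩ q ⟨y, hy, hq⟩
    obtain ⟨z, hz, hzz⟩ := hg x hx y hy
    refine ⟨z, ⟨hz, ?_⟩, fun u => z (u.1, u.2 + (n + k)), ?_, ?_⟩
    · rintro ⟨⟨i, j⟩, hu⟩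
      obtain ⟨⟨hi, hi'⟩, hj, hj'⟩ := mem_square.1 hu
      exact (hzz i j hi hi' hj hj').1.trans (hp ⟨_, hu⟩)
    · rintro ⟨⟨i, j⟩, hu⟩
      obtain ⟨⟨hi, hi'⟩, hj, hj'⟩ := mem_square.1 hu
      exact (hzz i j hi hi' hj hj').2.trans (hq ⟨_, hu⟩)
    · funext u
      simp [shift, -neg_add_rev]

/-! ### Window shifts as SFTs, and the product with a transposed layer -/

theorem isSFT_windowShift [Finite C] (P : C → C → C → C → Prop) : IsSFT (windowShift P) := by
  have m00 : ((0, 0) : ℤ × ℤ) ∈ square 2 := mem_square.2 (by norm_num)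
  have m10 : ((1, 0) : ℤ × ℤ) ∈ square 2 := mem_square.2 (by norm_num)
  have m01 : ((0, 1) : ℤ × ℤ) ∈ square 2 := mem_square.2 (by norm_num)
  have m11 : ((1, 1) : ℤ × ℤ) ∈ square 2 := mem_square.2 (by norm_num)
  refine ⟨Sigma.mk (square 2) '' {f | ¬P (f ⟨_, m00⟩) (f ⟨_, m10⟩) (f ⟨_, m01⟩) (f ⟨_, m11⟩)},
    (Set.toFinite _).image _, ?_⟩
  ext x
  constructor
  · rintro hx v _ ⟨f, hf, rfl⟩ hc
    refine hf ?_
    have := hx v.1 v.2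
    have h00 : shift v x (0, 0) = f ⟨_, m00⟩ := hc ⟨_, m00⟩
    have h10 : shift v x (1, 0) = f ⟨_, m10⟩ := hc ⟨_, m10⟩
    have h01 : shift v x (0, 1) = f ⟨_, m01⟩ := hc ⟨_, m01⟩
    have h11 : shift v x (1, 1) = f ⟨_, m11⟩ := hc ⟨_, m11⟩
    rw [← h00, ← h10, ← h01, ← h11]
    simpa [shift, add_comm (1 : ℤ), Prod.add_def] using this
  · intro hx i j
    by_contra hP
    refine hx (i, j) _ ⟨fun u => shift (i, j) x u, ?_, rfl⟩ fun _ => rfl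
    simpa [shift, add_comm (1 : ℤ), Prod.add_def] using hP

/-- The rule for pairs of a configuration and a transposed configuration. -/
def pairRule (P : C → C → C → C → Prop) (P' : C' → C' → C' → C' → Prop)
    (a b c d : C × C') : Prop := P a.1 b.1 c.1 d.1 ∧ P' a.2 c.2 b.2 d.2

section pairRule

variable {P : C → C → C → C → Prop} {P' : C' → C' → C' → C' → Prop}

theorem pair_mem {x : ℤ × ℤ → C} {y : ℤ × ℤ → C'} (hx : x ∈ windowShift P)
    (hy : y ∈ windowShift P') : (fun u => (x u, y u.swap)) ∈ windowShift (pairRule P P') :=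
  fun i j => ⟨hx i j, hy j i⟩

theorem fst_mem {z : ℤ × ℤ → C × C'} (hz : z ∈ windowShift (pairRule P P')) :
    (fun u => (z u).1) ∈ windowShift P := fun i j => (hz i j).1

theorem snd_mem {z : ℤ × ℤ → C × C'} (hz : z ∈ windowShift (pairRule P P')) :
    (fun u => (z u.swap).2) ∈ windowShift P' := fun i j => (hz j i).2

variable {n k : ℕ}

/-- The other layer is filled with a fixed configuration, so lower bounds for one layer pass to the
product. -/
theorem GlueableH.of_pairRule (h0 : (windowShift P').Nonempty)
    (hg : GlueableH (windowShift (pairRule P P')) n k) : GlueableH (windowShift P) n k := by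
  intro x hx y hy
  obtain ⟨a, ha⟩ := h0
  obtain ⟨z, hz, hzz⟩ := hg _ (pair_mem hx ha) _ (pair_mem hy ha)
  refine ⟨_, fst_mem hz, fun i j hi hi' hj hj' => ?_⟩
  have := hzz i j hi hi' hj hj'
  simp [this.1, this.2]

theorem GlueableV.of_pairRule (h0 : (windowShift P).Nonempty)
    (hg : GlueableV (windowShift (pairRule P P')) n k) : GlueableH (windowShift P') n k := by
  intro x hx y hy
  obtain ⟨a, ha⟩ := h0
  obtain ⟨z, hz, hzz⟩ := hg _ (pair_mem ha hx) _ (pair_mem ha hy)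
  refine ⟨_, snd_mem hz, fun i j hi hi' hj hj' => ?_⟩
  have := hzz j i hj hj' hi hi'
  simp [this.1, this.2]

theorem GlueableH.pairRule (h1 : GlueableH (windowShift P) n k)
    (h2 : GlueableV (windowShift P') n k) : GlueableH (windowShift (pairRule P P')) n k := by
  intro x hx y hy
  obtain ⟨z, hz, hzz⟩ := h1 _ (fst_mem hx) _ (fst_mem hy)
  obtain ⟨w, hw, hww⟩ := h2 _ (snd_mem hx) _ (snd_mem hy)
  refine ⟨_, pair_mem hz hw, fun i j hi hi' hj hj' => ?_⟩
  have ha := hzz i j hi hi' hj hj'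
  have hb := hww j i hj hj' hi hi'
  simp [ha.1, ha.2, hb.1, hb.2]

theorem GlueableV.pairRule (h1 : GlueableV (windowShift P) n k)
    (h2 : GlueableH (windowShift P') n k) : GlueableV (windowShift (pairRule P P')) n k := by
  intro x hx y hy
  obtain ⟨z, hz, hzz⟩ := h1 _ (fst_mem hx) _ (fst_mem hy)
  obtain ⟨w, hw, hww⟩ := h2 _ (snd_mem hx) _ (snd_mem hy)
  refine ⟨_, pair_mem hz hw, fun i j hi hi' hj hj' => ?_⟩
  have ha := hzz i j hi hi' hj hj'
  have hb := hww j i hj hj' hi hi'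
  simp [ha.1, ha.2, hb.1, hb.2]

end pairRule

/-- For every domino system with at least one picture there is a local rule whose gluing distances
are governed by the minimal widths of the pictures. -/
theorem exists_rule {G : Type} [Finite G] (D : Dominoes G) (hD : ∃ h m, 0 < h ∧ D.Has h m) :
    ∃ (C : Type) (_ : Finite C) (P : C → C → C → C → Prop), (windowShift P).Nonempty ∧
      (∀ n k, 1 ≤ n → GlueableH (windowShift P) n k → 1 ≤ k ∧ ∀ h m, 0 < h → h ≤ n →
        D.Has h m → (∀ m', D.Has h m' → m ≤ m') → 2 * (m + 1) + 1 ≤ k) ∧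
      ∀ n s k, 1 ≤ s → (∀ h m, 0 < h → h ≤ n → D.Has h m → ∃ m', m' + 1 ≤ s ∧ D.Has h m') →
        2 * s + 1 ≤ k → GlueableH (windowShift P) n k ∧ GlueableV (windowShift P) n k := by
  obtain ⟨c, ⟨e⟩⟩ := Finite.exists_equiv_fin (G ⊕ Bool)
  refine ⟨Cell (Tile (G ⊕ Bool) (Fin c × Fin 3)), inferInstance, Window (D.glueing (Fin c)),
    ⟨fun _ => .blank, fun _ _ => window_blank _⟩, fun n k hn hg => ⟨?_, ?_⟩, ?_⟩
  -- For `1 ≤ k` a picture of any height will do.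
  · obtain ⟨h, m, hh, hm⟩ := hD
    classical
    exact (lt_of_glued hh (Nat.find_spec ⟨m, hm⟩) (fun m' hm' => Nat.find_min' _ hm') e
      e.injective hn hg).1
  · intro h m hh hhn hm hmin
    exact (lt_of_glued hh hm hmin e e.injective hn hg).2 hhn
  · intro n s k hs hsh hk
    have : Nonempty (Tile (G ⊕ Bool) (Fin c × Fin 3)) :=
      ⟨⟨.inr true, (e (.inr true), 0), fun _ => true, true⟩⟩
    have key := fun x (hx : x ∈ brokenShift (D.glueing (Fin c))) y hy =>
      exists_glued (fun _ => Dominoes.glueing_terminates)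
        (fun _ => Dominoes.glueing_mirror_terminates) hs (Dominoes.glueing_short hsh) hk hx
        (y := y) hy
    exact ⟨fun x hx y hy => (key x hx y hy).1, fun x hx y hy => (key x hx y hy).2⟩

/-! ### Shapes and size functions -/

/-- The allowed dominoes for given forbidden ones. -/
def allowed {G : Type} (H V : Set (Option G × Option G)) : Dominoes G where
  hor a b := (some a, some b) ∉ H
  ver a b := (some a, some b) ∉ V
  left a := (none, some a) ∉ H
  right a := (some a, none) ∉ H
  bottom a := (none, some a) ∉ V
  top a := (some a, none) ∉ V

section padded

variable {A : Type*} (p : Picture A)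

theorem Picture.padded_zero_left (j : ℕ) : p.padded 0 j = none := by simp [Picture.padded]

theorem Picture.padded_zero_right (i : ℕ) : p.padded i 0 = none := by simp [Picture.padded]

theorem Picture.padded_of_width_lt {i : ℕ} (hi : p.width < i) (j : ℕ) : p.padded i j = none := by
  rw [Picture.padded, dif_neg (by omega)]

theorem Picture.padded_of_height_lt (i : ℕ) {j : ℕ} (hj : p.height < j) :
    p.padded i j = none := by
  rw [Picture.padded, dif_neg (by omega)]

theorem Picture.padded_succ {i j : ℕ} (hi : i < p.width) (hj : j < p.height) :
    p.padded (i + 1) (j + 1) = some (p.cell ⟨i, hi⟩ ⟨j, hj⟩) := by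
  rw [Picture.padded, dif_pos ⟨⟨by omega, by omega⟩, by omega, by omega⟩]
  rfl

end padded

/-- `allowed` forgets the dominoes made of two padding symbols. They occur in every padded picture,
so they have to be excluded from `H` and `V` by hypothesis. -/
theorem mem_shapes_dominoLanguage {G : Type} {H V : Set (Option G × Option G)}
    (hH : (none, none) ∉ H) (hV : (none, none) ∉ V) {a h : ℕ} :
    (a, h) ∈ shapes (dominoLanguage H V) ↔ ∃ m, a = m + 1 ∧ 0 < h ∧ (allowed H V).Has h m := by
  constructor
  · rintro ⟨p, ⟨h1, h2⟩, hp⟩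
    obtain ⟨rfl, rfl⟩ := Prod.mk.inj hp
    have hw := p.width_pos
    have hh := p.height_pos
    let w : ℕ → ℕ → G := fun i j => if hij : i < p.width ∧ j < p.height then
      p.cell ⟨i, hij.1⟩ ⟨j, hij.2⟩ else p.cell ⟨0, hw⟩ ⟨0, hh⟩
    have hpad : ∀ i j, i < p.width → j < p.height → p.padded (i + 1) (j + 1) = some (w i j) := by
      intro i j hi hj
      rw [p.padded_succ hi hj]
      simp [w, hi, hj]
    have hcol : ∀ i < p.width, (allowed H V).IsCol p.height (w i) := by
      intro i hi
      refine ⟨?_, ?_, fun j hj => ?_⟩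
      · have := h2 (i + 1) 0 (by omega) (by omega)
        rwa [hpad i 0 hi hh, p.padded_zero_right] at this
      · have := h2 (i + 1) (p.height - 1 + 1) (by omega) (by omega)
        rwa [hpad i _ hi (by omega), p.padded_of_height_lt _ (by omega)] at this
      · have := h2 (i + 1) (j + 1) (by omega) (by omega)
        rwa [hpad i _ hi (by omega), hpad i _ hi (by omega)] at this
    refine ⟨p.width - 1, by omega, hh, w 0, hcol 0 hw, fun j hj => ?_,
      Dominoes.ends_of_walk (k := p.width - 1) (w := w)
        (fun i hi => ⟨hcol _ (by omega), fun j hj => ?_⟩) (fun j hj => ?_) 0 (by omega)⟩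
    · have := h1 0 (j + 1) (by omega) (by omega)
      rwa [hpad 0 j hw hj, p.padded_zero_left] at this
    · have := h1 (i + 1) (j + 1) (by omega) (by omega)
      rwa [hpad i j (by omega) hj, hpad (i + 1) j (by omega) hj] at this
    · have := h1 (p.width - 1 + 1) (j + 1) (by omega) (by omega)
      rwa [hpad _ j (by omega) hj, p.padded_of_width_lt (by omega)] at this
  · rintro ⟨m, rfl, hh, c, hc, hl, hE⟩
    obtain ⟨w, rfl, hs, hr⟩ := Dominoes.exists_walk hE
    have hcol : ∀ i ≤ m, (allowed H V).IsCol h (w i) := fun i hi =>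
      (Dominoes.mirror_ends_of_walk hc hl hs i hi).1
    let p : Picture G := ⟨m + 1, h, by omega, hh, fun i j => w i j⟩
    have hpad : ∀ i j, i < m + 1 → j < h → p.padded (i + 1) (j + 1) = some (w i j) :=
      fun i j hi hj => p.padded_succ hi hj
    refine ⟨p, ⟨fun i j hi hj => ?_, fun i j hi hj => ?_⟩, rfl⟩
    · change i + 1 < m + 1 + 2 at hi
      change j < h + 2 at hj
      rcases j with _ | j
      · rwa [p.padded_zero_right, p.padded_zero_right]
      by_cases hjh : j < h
      swap
      · rwa [p.padded_of_height_lt i (show h < j + 1 by omega),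
          p.padded_of_height_lt _ (show h < j + 1 by omega)]
      rcases i with _ | i
      · rw [p.padded_zero_left, hpad 0 j (by omega) hjh]
        exact hl j hjh
      rw [hpad i j (by omega) hjh]
      by_cases him : i < m
      · rw [hpad (i + 1) j (by omega) hjh]
        exact (hs i him).2 j hjh
      · obtain rfl : i = m := by omega
        rw [p.padded_of_width_lt (show i + 1 < i + 1 + 1 by omega)]
        exact hr j hjh
    · change i < m + 1 + 2 at hi
      change j + 1 < h + 2 at hj
      rcases i with _ | i
      · rwa [p.padded_zero_left, p.padded_zero_left]
      by_cases him : i < m + 1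
      swap
      · rwa [p.padded_of_width_lt (show m + 1 < i + 1 by omega),
          p.padded_of_width_lt (show m + 1 < i + 1 by omega)]
      have hci := hcol i (by omega)
      rcases j with _ | j
      · rw [p.padded_zero_right, hpad i 0 him hh]
        exact hci.1
      rw [hpad i j him (by omega)]
      by_cases hjh : j + 1 < h
      · rw [hpad i (j + 1) him hjh]
        exact hci.3 j hjh
      · obtain rfl : h = j + 1 := by omega
        rw [p.padded_of_height_lt _ (show j + 1 < j + 1 + 1 by omega)]
        exact hci.2

/-! ### Transposed languages -/

/-- Transposition of a picture. -/
def Picture.transpose {A : Type*} (p : Picture A) : Picture A :=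
  ⟨p.height, p.width, p.height_pos, p.width_pos, fun i j => p.cell j i⟩

theorem Picture.padded_transpose {A : Type*} (p : Picture A) (i j : ℕ) :
    p.transpose.padded i j = p.padded j i := by
  unfold Picture.padded
  by_cases h : (1 ≤ j ∧ j - 1 < p.width) ∧ (1 ≤ i ∧ i - 1 < p.height)
  · rw [dif_pos h]
    exact dif_pos (And.intro h.2 h.1)
  · rw [dif_neg h]
    exact dif_neg fun h' => h ⟨h'.2, h'.1⟩

theorem swap_mem_shapes {G : Type} {H V : Set (Option G × Option G)} {a b : ℕ}
    (h : (a, b) ∈ shapes (dominoLanguage H V)) : (b, a) ∈ shapes (dominoLanguage V H) := by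
  obtain ⟨p, ⟨h1, h2⟩, hp⟩ := h
  obtain ⟨rfl, rfl⟩ := Prod.mk.inj hp
  refine ⟨p.transpose, ⟨fun i j hi hj => ?_, fun i j hi hj => ?_⟩, rfl⟩
  · rw [p.padded_transpose, p.padded_transpose]
    exact h2 j i hj hi
  · rw [p.padded_transpose, p.padded_transpose]
    exact h1 j i hj hi

theorem shapes_map_image {A A' : Type*} (π : A → A') (L : Set (Picture A)) :
    shapes (Picture.map π '' L) = shapes L := by
  rw [shapes, Set.image_image]
  rfl

/-! ### Minimal widths and relaxed sizes -/

section sizes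

variable {A A' : Type*} {L : Set (Picture A)} {L' : Set (Picture A')}

theorem relaxedSizeV_eq (h : ∀ a b, (a, b) ∈ shapes L ↔ (b, a) ∈ shapes L') (n : ℕ) :
    relaxedSizeV L n = relaxedSizeH L' n := by
  simp only [relaxedSizeV, relaxedSizeH, sizeV, sizeH, h]

theorem relaxedSizeH_congr (h : shapes L = shapes L') (n : ℕ) :
    relaxedSizeH L n = relaxedSizeH L' n := by
  simp only [relaxedSizeH, sizeH, h]

theorem sizeH_le {a n : ℕ} (h : (a, n) ∈ shapes L) : sizeH L n ≤ a := sInf_le ⟨a, h, rfl⟩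

theorem exists_of_sizeH_lt_top {n : ℕ} (h : sizeH L n < ⊤) :
    ∃ a : ℕ, sizeH L n = a ∧ (a, n) ∈ shapes L ∧ ∀ b, (b, n) ∈ shapes L → a ≤ b := by
  have hne : {s : ℕ∞ | ∃ m : ℕ, (m, n) ∈ shapes L ∧ s = (m : ℕ∞)}.Nonempty := by
    by_contra hcon
    rw [sizeH, Set.not_nonempty_iff_eq_empty.1 hcon, sInf_empty] at h
    exact h.false
  obtain ⟨a, ha, has⟩ := csInf_mem hne
  have has : sizeH L n = a := has
  exact ⟨a, has, ha, fun b hb => by simpa [has] using sizeH_le hb⟩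

theorem sizeH_le_relaxedSizeH {n' n a : ℕ} (hn : n' ≤ n) (h : (a, n') ∈ shapes L) :
    sizeH L n' ≤ relaxedSizeH L n :=
  le_sSup ⟨n', hn, (sizeH_le h).trans_lt (ENat.natCast_lt_top a), rfl⟩

theorem relaxedSizeH_le {n b : ℕ} (h : ∀ n' ≤ n, ∀ a, (a, n') ∈ shapes L →
    (∀ a', (a', n') ∈ shapes L → a ≤ a') → a ≤ b) : relaxedSizeH L n ≤ b := by
  refine sSup_le ?_
  rintro s ⟨n', hn', hlt, rfl⟩
  obtain ⟨a, ha, h1, h2⟩ := exists_of_sizeH_lt_top hlt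
  rw [ha]
  exact_mod_cast h n' hn' a h1 h2

theorem relaxedSizeH_lt_top (L : Set (Picture A)) (n : ℕ) : relaxedSizeH L n < ⊤ := by
  refine lt_of_le_of_lt (b := ((∑ i ∈ Finset.range (n + 1), (sizeH L i).toNat : ℕ) : ℕ∞))
    (relaxedSizeH_le fun n' hn' a h1 h2 => ?_) (ENat.natCast_lt_top _)
  obtain ⟨b, hb, hb', -⟩ := exists_of_sizeH_lt_top ((sizeH_le h1).trans_lt (ENat.natCast_lt_top a))
  calc a ≤ b := h2 b hb'
    _ = (sizeH L n').toNat := by rw [hb, ENat.toNat_natCast]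
    _ ≤ _ := Finset.single_le_sum (f := fun i => (sizeH L i).toNat) (fun _ _ => Nat.zero_le _)
        (Finset.mem_range.2 (by omega))

theorem one_le_relaxedSizeH {a n' n : ℕ} (h : (a, n') ∈ shapes L) (hn : n' ≤ n) :
    1 ≤ relaxedSizeH L n := by
  refine le_trans ?_ (sizeH_le_relaxedSizeH hn h)
  refine le_sInf ?_
  rintro _ ⟨m, ⟨p, -, hp⟩, rfl⟩
  obtain ⟨rfl, -⟩ := Prod.mk.inj hp
  exact_mod_cast p.width_pos

end sizes

/-- `(k - 1) / 2` is the largest natural number `a` with `2 * a + 1 ≤ k`; `relaxedSizeH_le` requires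
a natural bound. -/
theorem two_mul_add_one_le {a : ℕ∞} {k : ℕ} (hk : 1 ≤ k) (h : a ≤ ((k - 1) / 2 : ℕ)) :
    2 * a + 1 ≤ k := by
  calc 2 * a + 1 ≤ 2 * (((k - 1) / 2 : ℕ) : ℕ∞) + 1 := by gcongr
    _ ≤ k := by
      norm_cast
      omega

/-! ### The theorem for nonempty and for empty languages -/

theorem exists_sft_of_nonempty {A : Type*} {L : Set (Picture A)} (hL : IsRecognizable L)
    (hne : L.Nonempty) :
    ∃ (C : Type) (_ : Finite C) (X : Set (ℤ × ℤ → C)), IsSFT X ∧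
      (∀ n : ℕ, 1 ≤ n → 2 * relaxedSizeH L n + 1 ≤ blockGluingH X n) ∧
      (∀ n : ℕ, 1 ≤ n → 2 * relaxedSizeV L n + 1 ≤ blockGluingV X n) ∧
      ∀ᶠ n : ℕ in Filter.atTop, blockGluing X n = max 3 (2 * relaxedSize L n + 1) := by
  obtain ⟨G, _, H, V, π, rfl⟩ := hL
  obtain ⟨_, p, hp, rfl⟩ := hne
  have hH : (none, none) ∉ H := by
    simpa [p.padded_zero_right] using hp.1 0 0 (by omega) (by omega)
  have hV : (none, none) ∉ V := by
    simpa [p.padded_zero_left] using hp.2 0 0 (by omega) (by omega)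
  have hsH : ∀ n, relaxedSizeH (Picture.map π '' dominoLanguage H V) n =
      relaxedSizeH (dominoLanguage H V) n := relaxedSizeH_congr (shapes_map_image _ _)
  have hsV : ∀ n, relaxedSizeV (Picture.map π '' dominoLanguage H V) n =
      relaxedSizeH (dominoLanguage V H) n := relaxedSizeV_eq fun a b => by
    rw [shapes_map_image]
    exact ⟨swap_mem_shapes, swap_mem_shapes⟩
  have hp1 : (p.width, p.height) ∈ shapes (dominoLanguage H V) := ⟨p, hp, rfl⟩
  have hp2 := swap_mem_shapes hp1
  have hlow : ∀ {H V : Set (Option G × Option G)} (_ : (none, none) ∉ H) (_ : (none, none) ∉ V)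
      {n k : ℕ}, (1 ≤ k ∧ ∀ h m, 0 < h → h ≤ n → (allowed H V).Has h m →
        (∀ m', (allowed H V).Has h m' → m ≤ m') → 2 * (m + 1) + 1 ≤ k) →
      2 * relaxedSizeH (dominoLanguage H V) n + 1 ≤ k := by
    intro H V hH hV n k ⟨hk, h1⟩
    refine two_mul_add_one_le hk (relaxedSizeH_le fun n' hn' a ha hmin => ?_)
    simp only [mem_shapes_dominoLanguage hH hV] at ha hmin
    obtain ⟨m, rfl, hh, hm⟩ := ha
    have := h1 n' m hh hn' hm fun m' hm' => by
      have := hmin (m' + 1) ⟨m', rfl, hh, hm'⟩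
      omega
    omega
  have hup : ∀ {H V : Set (Option G × Option G)} (_ : (none, none) ∉ H) (_ : (none, none) ∉ V)
      {n s : ℕ}, relaxedSizeH (dominoLanguage H V) n ≤ s →
      ∀ h m, 0 < h → h ≤ n → (allowed H V).Has h m →
        ∃ m', m' + 1 ≤ s ∧ (allowed H V).Has h m' := by
    intro H V hH hV n s hs h m hh hhn hm
    have hm' := (mem_shapes_dominoLanguage hH hV).2 ⟨m, rfl, hh, hm⟩
    obtain ⟨a, ha, ha', -⟩ :=
      exists_of_sizeH_lt_top ((sizeH_le hm').trans_lt (ENat.natCast_lt_top _))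
    have hle := (sizeH_le_relaxedSizeH hhn hm').trans hs
    rw [ha] at hle
    obtain ⟨m', rfl, -, hm'⟩ := (mem_shapes_dominoLanguage hH hV).1 ha'
    exact ⟨m', by exact_mod_cast hle, hm'⟩
  have hex : ∀ {H V : Set (Option G × Option G)} (_ : (none, none) ∉ H) (_ : (none, none) ∉ V)
      {a b : ℕ}, (a, b) ∈ shapes (dominoLanguage H V) →
      ∃ h m, 0 < h ∧ (allowed H V).Has h m := by
    intro H V hH hV a b hab
    obtain ⟨m, -, hh, hm⟩ := (mem_shapes_dominoLanguage hH hV).1 hab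
    exact ⟨b, m, hh, hm⟩
  obtain ⟨C, _, P, hP, hlowP, hupP⟩ := exists_rule (allowed H V) (hex hH hV hp1)
  obtain ⟨C', _, P', hP', hlowP', hupP'⟩ := exists_rule (allowed V H) (hex hV hH hp2)
  have hlowH : ∀ n : ℕ, 1 ≤ n → 2 * relaxedSizeH (Picture.map π '' dominoLanguage H V) n + 1 ≤
      blockGluingH (windowShift (pairRule P P')) n := by
    intro n hn
    refine le_sInf ?_
    rintro _ ⟨k, hk, rfl⟩
    rw [hsH]
    exact hlow hH hV (hlowP n k hn ((gluesH_iff.1 hk).of_pairRule hP'))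
  have hlowV : ∀ n : ℕ, 1 ≤ n → 2 * relaxedSizeV (Picture.map π '' dominoLanguage H V) n + 1 ≤
      blockGluingV (windowShift (pairRule P P')) n := by
    intro n hn
    refine le_sInf ?_
    rintro _ ⟨k, hk, rfl⟩
    rw [hsV]
    exact hlow hV hH (hlowP' n k hn ((gluesV_iff.1 hk).of_pairRule hP))
  refine ⟨C × C', inferInstance, _, isSFT_windowShift (pairRule P P'), hlowH, hlowV, ?_⟩
  -- From the height of one picture on, `S'_H ≥ 1`, so the maximum with 3 can be dropped.
  filter_upwards [Filter.eventually_ge_atTop p.height] with n hn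
  have hn1 : 1 ≤ n := p.height_pos.trans_le hn
  obtain ⟨s, hs⟩ : ∃ s : ℕ, relaxedSize (Picture.map π '' dominoLanguage H V) n = s := by
    refine ENat.ne_top_iff_exists.1 (ne_of_lt ?_) |>.imp fun _ h => h.symm
    rw [relaxedSize, hsH, hsV]
    exact max_lt (relaxedSizeH_lt_top _ n) (relaxedSizeH_lt_top _ n)
  have h1s : 1 ≤ s := by
    have : (1 : ℕ∞) ≤ s := by
      rw [← hs, relaxedSize, hsH]
      exact (one_le_relaxedSizeH hp1 hn).trans (le_max_left _ _)
    exact_mod_cast this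
  have hmax : max 3 (2 * (s : ℕ∞) + 1) = ((2 * s + 1 : ℕ) : ℕ∞) := by
    rw [max_eq_right (by norm_cast; omega)]
    norm_cast
  -- With `s = S'(n)` the same gap serves both layers in both directions. Only the maximum of the
  -- two gluing functions is determined exactly.
  have h1 := hupP n s (2 * s + 1) h1s (hup hH hV (by
    rw [← hs, ← hsH]
    exact le_max_left _ _)) le_rfl
  have h2 := hupP' n s (2 * s + 1) h1s (hup hV hH (by
    rw [← hs, ← hsV]
    exact le_max_right _ _)) le_rfl
  rw [hs, hmax]
  refine le_antisymm (max_le ?_ ?_) ?_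
  · exact sInf_le ⟨_, gluesH_iff.2 (h1.1.pairRule h2.2), rfl⟩
  · exact sInf_le ⟨_, gluesV_iff.2 (h1.2.pairRule h2.1), rfl⟩
  · have : ((2 * s + 1 : ℕ) : ℕ∞) =
        2 * relaxedSize (Picture.map π '' dominoLanguage H V) n + 1 := by
      rw [hs]
      norm_cast
    rw [this, relaxedSize]
    rcases le_total (relaxedSizeH (Picture.map π '' dominoLanguage H V) n)
      (relaxedSizeV (Picture.map π '' dominoLanguage H V) n) with h | h
    · rw [max_eq_right h]
      exact (hlowV n hn1).trans (le_max_right _ _)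
    · rw [max_eq_left h]
      exact (hlowH n hn1).trans (le_max_left _ _)

theorem mem_shapes_univ {a b : ℕ} :
    (a, b) ∈ shapes (Set.univ : Set (Picture Unit)) ↔ 0 < a ∧ 0 < b := by
  constructor
  · rintro ⟨p, -, hp⟩
    obtain ⟨rfl, rfl⟩ := Prod.mk.inj hp
    exact ⟨p.width_pos, p.height_pos⟩
  · rintro ⟨ha, hb⟩
    exact ⟨⟨a, b, ha, hb, fun _ _ => ()⟩, trivial, rfl⟩

theorem isRecognizable_univ : IsRecognizable (Set.univ : Set (Picture Unit)) := by
  refine ⟨Unit, inferInstance, ∅, ∅, id, Set.eq_of_subset_of_subset (fun p _ => ?_) (by simp)⟩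
  exact ⟨p, ⟨by simp, by simp⟩, rfl⟩

theorem relaxedSize_univ {n : ℕ} (hn : 1 ≤ n) :
    relaxedSize (Set.univ : Set (Picture Unit)) n = 1 := by
  have hV : relaxedSizeV (Set.univ : Set (Picture Unit)) n = relaxedSizeH Set.univ n :=
    relaxedSizeV_eq (fun a b => by rw [mem_shapes_univ, mem_shapes_univ, and_comm]) n
  rw [relaxedSize, hV, max_self]
  refine le_antisymm ?_ (one_le_relaxedSizeH (mem_shapes_univ.2 ⟨one_pos, one_pos⟩) hn)
  refine relaxedSizeH_le (b := 1) fun n' _ a ha hmin => hmin 1 ?_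
  exact mem_shapes_univ.2 ⟨one_pos, (mem_shapes_univ.1 ha).2⟩

theorem relaxedSizeH_empty {A : Type*} (n : ℕ) : relaxedSizeH (∅ : Set (Picture A)) n = 0 := by
  refine le_antisymm (relaxedSizeH_le (b := 0) fun n' _ a ha => ?_) zero_le
  simp [shapes] at ha

theorem relaxedSizeV_empty {A : Type*} (n : ℕ) : relaxedSizeV (∅ : Set (Picture A)) n = 0 := by
  rw [relaxedSizeV_eq (L' := (∅ : Set (Picture A))) (by simp [shapes]), relaxedSizeH_empty]

end BlockGluing

theorem mainTheorem5 {A : Type*} [Finite A] (L : Set (BlockGluing.Picture A))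
    (hL : BlockGluing.IsRecognizable L) :
    ∃ (C : Type) (_ : Finite C) (X : Set (ℤ × ℤ → C)), BlockGluing.IsSFT X ∧
      (∀ n : ℕ, 1 ≤ n →
        2 * BlockGluing.relaxedSizeH L n + 1 ≤ BlockGluing.blockGluingH X n) ∧
      (∀ n : ℕ, 1 ≤ n →
        2 * BlockGluing.relaxedSizeV L n + 1 ≤ BlockGluing.blockGluingV X n) ∧
      (∀ᶠ n : ℕ in Filter.atTop,
        BlockGluing.blockGluing X n = max 3 (2 * BlockGluing.relaxedSize L n + 1)) := by
  open BlockGluing in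
  rcases L.eq_empty_or_nonempty with rfl | hne
  -- The language of all unary pictures has relaxed size 1, which yields the required value 3 when
  -- all relaxed sizes of `L` are 0.
  · obtain ⟨C, hC, X, hX, hH, hV, hB⟩ :=
      exists_sft_of_nonempty isRecognizable_univ
        ⟨⟨1, 1, one_pos, one_pos, fun _ _ => ()⟩, trivial⟩
    refine ⟨C, hC, X, hX, fun n hn => le_trans ?_ (hH n hn), fun n hn => le_trans ?_ (hV n hn), ?_⟩
    · simp [relaxedSizeH_empty]
    · simp [relaxedSizeV_empty]
    · filter_upwards [hB, Filter.eventually_ge_atTop 1] with n hn hn1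
      rw [hn, relaxedSize_univ hn1, relaxedSize, relaxedSizeH_empty, relaxedSizeV_empty, max_self]
      norm_num
  · exact exists_sft_of_nonempty hL hne
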